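/- **Definitions.** Let $f:[a,b]\to\mathbb R^2$ and $g:[c,d]\to\mathbb R^2$ be curves (continuous maps). They are *isometric* if there are an isometry $h$ of the line with $h([a,b])=[c,d]$ and an isometry $h'$ of the Euclidean plane such that $h'\circ f=g\circ h$ on $[a,b]$. They are *similar* if for some $k>0$ the curve $t\mapsto\sqrt k\,f(t/k)$, $t\in[ka,kb]$, is isometric to $g$. A *fractal period* of $f$ is a nondegenerate segment properly contained in $[a,b]$ such that the restriction of $f$ to it is similar to $f$; it is *maximal* if it is contained in no other fractal period. The curve $f$ is *fractal* if every point of $[a,b]$ belongs to a fractal period. A fractal curve is a *regular Peano curve* if its image is a (nondegenerate) square and its maximal fractal periods form a regular partition of $[a,b]$, that is, they are finitely many segments of equal length with union $[a,b]$ and pairwise disjoint interiors. A *unit* Peano curve is a continuous map of $[0,1]$ onto the unit square $[0,1]^2$. Such a curve is *one-sided* if its start $f(0)$ and its end $f(1)$ lie on one and the same side of the square. **Theorem.** Let $f:[0,1]\to[0,1]^2$ be a unit regular one-sided Peano curve. Then the square-to-linear ratio of $f$ is at least $5$: there are $t\ne t'$ in $[0,1]$ with $$\frac{|f(t)-f(t')|^2}{|t-t'|}\ge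 5 .$$ -/

import Mathlib

open Set

/-- The Euclidean plane. -/
abbrev Plane : Type := EuclideanSpace ℝ (Fin 2)

/-- The curves `f` on `[a, b]` and `g` on `[c, d]` are isometric: there are an isometry `h` of the
line carrying `[a, b]` onto `[c, d]` and an isometry `h'` of the plane with `h' ∘ f = g ∘ h`
(both may reverse orientation). -/
def IsometricCurves (f : ℝ → Plane) (a b : ℝ) (g : ℝ → Plane) (c d : ℝ) : Prop :=
  ∃ (h : ℝ ≃ᵢ ℝ) (h' : Plane ≃ᵢ Plane),
    h '' Icc a b = Icc c d ∧ ∀ t ∈ Icc a b, h' (f t) = g (h t)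

/-- The curves `f` on `[a, b]` and `g` on `[c, d]` are similar: for some coefficient `k > 0`
the curve `t ↦ √k f(t / k)` on `[k a, k b]` is isometric to `g`. -/
def SimilarCurves (f : ℝ → Plane) (a b : ℝ) (g : ℝ → Plane) (c d : ℝ) : Prop :=
  ∃ k : ℝ, 0 < k ∧ IsometricCurves (fun t => √k • f (t / k)) (k * a) (k * b) g c d

/-- `[c, d]` is a fractal period of the curve `f` on `[a, b]`: a nondegenerate segment, properly
contained in `[a, b]`, on which the restriction of `f` is similar to the whole curve. -/
def IsFractalPeriod (f : ℝ → Plane) (a b c d : ℝ) : Prop :=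
  c < d ∧ Icc c d ⊂ Icc a b ∧ SimilarCurves f a b f c d

/-- A fractal period that is contained in no other fractal period. -/
def IsMaximalPeriod (f : ℝ → Plane) (a b c d : ℝ) : Prop :=
  IsFractalPeriod f a b c d ∧
    ∀ c' d' : ℝ, IsFractalPeriod f a b c' d' → Icc c d ⊆ Icc c' d' → c' = c ∧ d' = d

/-- The segments `[l i, r i]`, `i < n`, form a regular partition of `[a, b]`: they have equal
lengths, their union is `[a, b]`, and different ones have disjoint interiors. -/
def IsRegularPartition {n : ℕ} (l r : Fin n → ℝ) (a b : ℝ) : Prop :=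
  (∀ i, l i < r i) ∧ (∀ i j, r i - l i = r j - l j) ∧
    (⋃ i, Icc (l i) (r i)) = Icc a b ∧
    ∀ i j, i ≠ j → Disjoint (interior (Icc (l i) (r i))) (interior (Icc (l j) (r j)))

/-- Every moment of the domain `[a, b]` lies in some fractal period. -/
def IsFractalCurve (f : ℝ → Plane) (a b : ℝ) : Prop :=
  ∀ t ∈ Icc a b, ∃ c d : ℝ, IsFractalPeriod f a b c d ∧ t ∈ Icc c d

/-- The square `[0, s] × [0, s]`. -/
def square (s : ℝ) : Set Plane := {x | ∀ i, x i ∈ Icc 0 s}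

/-- A square of positive side length, in any position in the plane. -/
def IsPlaneSquare (S : Set Plane) : Prop :=
  ∃ (s : ℝ) (g : Plane ≃ᵢ Plane), 0 < s ∧ S = g '' square s

/-- A regular fractal Peano curve on `[a, b]`: a continuous fractal curve whose image is a square
and whose maximal fractal periods form a regular partition of `[a, b]`. -/
def IsRegularPeano (f : ℝ → Plane) (a b : ℝ) : Prop :=
  ContinuousOn f (Icc a b) ∧ IsFractalCurve f a b ∧ IsPlaneSquare (f '' Icc a b) ∧
    ∃ (n : ℕ) (l r : Fin n → ℝ), IsRegularPartition l r a b ∧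
      ∀ c d : ℝ, IsMaximalPeriod f a b c d ↔ ∃ i, l i = c ∧ r i = d

/-- A unit Peano curve: a continuous map of `[0, 1]` onto the unit square. -/
def IsUnitPeano (f : ℝ → Plane) : Prop :=
  ContinuousOn f (Icc 0 1) ∧ f '' Icc 0 1 = square 1

/-- A side of the unit square. -/
def IsUnitSquareSide (S : Set Plane) : Prop :=
  ∃ (i : Fin 2) (e : ℝ), (e = 0 ∨ e = 1) ∧ S = {x ∈ square 1 | x i = e}

/-- A unit Peano curve whose start and end lie on one side of the unit square. -/
def IsOneSided (f : ℝ → Plane) : Prop :=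
  ∃ S : Set Plane, IsUnitSquareSide S ∧ f 0 ∈ S ∧ f 1 ∈ S

/-- The square-to-linear ratio of `f` on the pair of moments `t`, `t'`. -/
noncomputable def squareLinearRatio (f : ℝ → Plane) (t t' : ℝ) : ℝ :=
  dist (f t) (f t') ^ 2 / |t - t'|

/-- Squared Euclidean distance of two points of `ℝ × ℝ`. -/
def sqd (p q : ℝ × ℝ) : ℝ := (p.1 - q.1) ^ 2 + (p.2 - q.2) ^ 2

/-- Product in the Klein four-group `{±1, ±S}`, `S` the swap of coordinates; the element `±S ^ m`
is encoded by its sign and the parity of `m`. -/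
def kmul (g h : Bool × Bool) : Bool × Bool := (xor g.1 h.1, xor g.2 h.2)

/-- Conjugation by the reflection `(x, y) ↦ (-x, y)`, which exchanges `S` and `-S`. -/
def kconj (g : Bool × Bool) : Bool × Bool := (xor g.1 g.2, g.2)

/-- Action of the Klein four-group on the plane. -/
def kact (g : Bool × Bool) (v : ℝ × ℝ) : ℝ × ℝ :=
  bif g.1 then -(bif g.2 then v.swap else v) else (bif g.2 then v.swap else v)

/-- The reflection `(x, y) ↦ (-x, y)`. -/
def xrefl (v : ℝ × ℝ) : ℝ × ℝ := (-v.1, v.2)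

theorem kact_add (g : Bool × Bool) (v w : ℝ × ℝ) : kact g (v + w) = kact g v + kact g w := by
  rcases g with ⟨_ | _, _ | _⟩ <;> ext <;> simp [kact] <;> ring

theorem kact_kact (g h : Bool × Bool) (v : ℝ × ℝ) : kact g (kact h v) = kact (kmul g h) v := by
  rcases g with ⟨_ | _, _ | _⟩ <;> rcases h with ⟨_ | _, _ | _⟩ <;> ext <;> simp [kact, kmul]

theorem kact_smul (g : Bool × Bool) (c : ℝ) (v : ℝ × ℝ) : kact g (c • v) = c • kact g v := by
  rcases g with ⟨_ | _, _ | _⟩ <;> ext <;> simp [kact]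

theorem xrefl_kact_xrefl (g : Bool × Bool) (v : ℝ × ℝ) :
    xrefl (kact g (xrefl v)) = kact (kconj g) v := by
  rcases g with ⟨_ | _, _ | _⟩ <;> ext <;> simp [kact, kconj, xrefl]

/-- The pieces `[k / M, (k + 1) / M]` of the curve `g`, magnified `N` times, are images of the
curves `F true`, `F false` under elements of the Klein four-group followed by translations. -/
def IsCellChain (F : Bool → ℝ → ℝ × ℝ) (M : ℕ) (N : ℝ) (g : ℝ → ℝ × ℝ) (a : ℕ → ℝ × ℝ)
    (G : ℕ → Bool × Bool) (σ : ℕ → Bool) : Prop :=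
  ∀ k < M, ∀ t ∈ Icc (0 : ℝ) 1, N • g ((k + t) / M) = a k + kact (G k) (F (σ k) t)

/-- Any two distinct moments of the curve have square-to-linear ratio less than `5`. -/
def RatioLt (g : ℝ → ℝ × ℝ) : Prop :=
  ∀ t ∈ Icc (0 : ℝ) 1, ∀ t' ∈ Icc (0 : ℝ) 1, t < t' → sqd (g t) (g t') < 5 * (t' - t)

/-- Both curves go from `(0, 0)` to `(1, 0)`; `F b` visits `(1, 1)` at `d b` and `(0, 1)` at
`1 - d (!b)`. -/
structure IsNormal (F : Bool → ℝ → ℝ × ℝ) (d : Bool → ℝ) : Prop where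
  start : ∀ b, F b 0 = (0, 0)
  finish : ∀ b, F b 1 = (1, 0)
  mem : ∀ b, d b ∈ Icc (0 : ℝ) 1
  far : ∀ b, F b (d b) = (1, 1)
  near : ∀ b, F b (1 - d (!b)) = (0, 1)

section chain

variable {F : Bool → ℝ → ℝ × ℝ} {M : ℕ} {N : ℝ} {g : ℝ → ℝ × ℝ} {a : ℕ → ℝ × ℝ}
  {G : ℕ → Bool × Bool} {σ : ℕ → Bool} {d : Bool → ℝ}

theorem RatioLt.scaled (hlt : RatioLt g) (hN : N ^ 2 = M) {i j : ℕ} (hi : i < M) (hj : j < M)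
    {t t' : ℝ} (ht : t ∈ Icc (0 : ℝ) 1) (ht' : t' ∈ Icc (0 : ℝ) 1) (h : i + t < j + t') :
    sqd (N • g ((i + t) / M)) (N • g ((j + t') / M)) < 5 * ((j + t') - (i + t)) := by
  have hM : (0 : ℝ) < M := by exact_mod_cast (Nat.zero_le i).trans_lt hi
  have mem : ∀ k < M, ∀ r ∈ Icc (0 : ℝ) 1, ((k + r) / M : ℝ) ∈ Icc (0 : ℝ) 1 := by
    intro k hk r hr
    have : (k : ℝ) + 1 ≤ M := by exact_mod_cast hk
    have := hr.1
    have := hr.2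
    exact ⟨by positivity, by rw [div_le_one hM]; linarith⟩
  have key := hlt _ (mem i hi t ht) _ (mem j hj t' ht') (by gcongr)
  have e : ∀ p q : ℝ × ℝ, sqd (N • p) (N • q) = M * sqd p q := by
    intro p q
    simp only [sqd, ← hN, Prod.smul_fst, Prod.smul_snd, smul_eq_mul]
    ring
  rw [e]
  have e2 : 5 * (((j : ℝ) + t') - (i + t)) = M * (5 * ((j + t') / M - (i + t) / M)) := by
    field_simp
  rw [e2]
  exact mul_lt_mul_of_pos_left key hM

theorem IsCellChain.sqd_lt (hc : IsCellChain F M N g a G σ) (hlt : RatioLt g) (hN : N ^ 2 = M)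
    {i j : ℕ} (hi : i < M) (hj : j < M) {t t' : ℝ} (ht : t ∈ Icc (0 : ℝ) 1)
    (ht' : t' ∈ Icc (0 : ℝ) 1) (h : i + t < j + t') :
    sqd (a i + kact (G i) (F (σ i) t)) (a j + kact (G j) (F (σ j) t')) <
      5 * ((j + t') - (i + t)) := by
  rw [← hc i hi t ht, ← hc j hj t' ht']
  exact hlt.scaled hN hi hj ht ht' h

theorem IsCellChain.step (hc : IsCellChain F M N g a G σ) (hF : IsNormal F d) {k : ℕ} (hk : k + 1 < M) :
    a (k + 1) = a k + kact (G k) (1, 0) := by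
  have h1 := hc k (by omega) 1 (by simp)
  have h2 := hc (k + 1) hk 0 (by simp)
  rw [hF.finish] at h1
  rw [hF.start] at h2
  have e : kact (G (k + 1)) (0, 0) = 0 := by
    rcases G (k + 1) with ⟨_ | _, _ | _⟩ <;> simp [kact]
  simp only [e, add_zero] at h2
  rw [← h1, ← h2]
  push_cast
  ring_nf

theorem IsCellChain.run (hc : IsCellChain F M N g a G σ) (hF : IsNormal F d) {i c : ℕ} (hk : i + c < M)
    (hG : ∀ m < c, G (i + m) = G i) : a (i + c) = a i + (c : ℝ) • kact (G i) (1, 0) := by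
  induction c with
  | zero => simp
  | succ c ih =>
    have := hc.step hF (k := i + c) (by omega)
    rw [← add_assoc, this, ih (by omega) (fun m hm => hG m (by omega)), hG c (by omega)]
    push_cast
    rw [add_smul, one_smul, add_assoc]

/-- The orientation of the two curves that reaches `(1, 1)` sooner. -/
def IsEarly (d : Bool → ℝ) (b : Bool) : Prop := d b ≤ d (!b)

theorem IsEarly.eq_of_lt {b x y : Bool} (hb : IsEarly d b) (h : d x < d y) : x = b ∧ y = !b := by
  unfold IsEarly at hb
  cases b <;> cases x <;> cases y <;> simp at * <;> linarith

theorem IsCellChain.rule_left (hc : IsCellChain F M N g a G σ) (hlt : RatioLt g) (hN : N ^ 2 = M)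
    (hF : IsNormal F d) {b : Bool} (hb : IsEarly d b) {i c : ℕ} (hk : i + 1 + c < M)
    (h1 : G (i + 1) = kmul (G i) (true, true)) (h2 : ∀ m ≤ c, G (i + 1 + m) = G (i + 1)) :
    σ i = b ∧ σ (i + 1 + c) = !b := by
  apply hb.eq_of_lt
  by_contra! hd
  have hdi := hF.mem (σ i)
  have hdj := hF.mem (σ (i + 1 + c))
  have hc0 : (0 : ℝ) ≤ c := by positivity
  have hrun := hc.run hF hk (fun m hm => h2 m hm.le)
  have hstep := hc.step hF (k := i) (by omega)
  have hG := h2 c le_rfl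
  have e : sqd (a i + kact (G i) (F (σ i) (d (σ i))))
      (a (i + 1 + c) + kact (G (i + 1 + c)) (F (σ (i + 1 + c)) (d (σ (i + 1 + c))))) =
      ((c : ℝ) + 2) ^ 2 + 1 := by
    rw [hF.far, hF.far, hrun, hstep, hG, h1]
    rcases G i with ⟨_ | _, _ | _⟩ <;> simp [kact, kmul, sqd] <;> ring
  have hpos : (i : ℝ) + d (σ i) < ((i + 1 + c : ℕ) : ℝ) + d (σ (i + 1 + c)) := by
    by_contra! h
    have h3 : d (σ i) = 1 := by
      push_cast at h
      linarith [hdi.1, hdi.2, hdj.1, hdj.2]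
    have := hF.far (σ i)
    rw [h3, hF.finish] at this
    simp at this
  have := hc.sqd_lt hlt hN (by omega) hk hdi hdj hpos
  rw [e] at this
  push_cast at this
  have hcc : (c : ℝ) * (c - 1) ≥ 0 := by
    rcases Nat.eq_zero_or_pos c with h | h
    · simp [h]
    · have : (1 : ℝ) ≤ c := by exact_mod_cast h
      nlinarith
  nlinarith

theorem IsCellChain.rule_right (hc : IsCellChain F M N g a G σ) (hlt : RatioLt g) (hN : N ^ 2 = M)
    (hF : IsNormal F d) {b : Bool} (hb : IsEarly d b) {i c : ℕ} (hk : i + c + 1 < M)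
    (h1 : G (i + c + 1) = kmul (G i) (false, true)) (h2 : ∀ m ≤ c, G (i + m) = G i) :
    σ i = b ∧ σ (i + c + 1) = !b := by
  suffices h : (!σ (i + c + 1)) = b ∧ (!σ i) = !b by
    refine ⟨by simpa using h.2, by rw [← h.1]; simp⟩
  apply hb.eq_of_lt
  by_contra! hd
  have hdi := hF.mem (!σ i)
  have hdj := hF.mem (!σ (i + c + 1))
  have hc0 : (0 : ℝ) ≤ c := by positivity
  have hrun := hc.run hF (i := i) (c := c + 1) hk (fun m hm => h2 m (by omega))
  rw [← add_assoc] at hrun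
  have e : sqd (a i + kact (G i) (F (σ i) (1 - d (!σ i))))
      (a (i + c + 1) + kact (G (i + c + 1)) (F (σ (i + c + 1)) (1 - d (!σ (i + c + 1))))) =
      ((c : ℝ) + 2) ^ 2 + 1 := by
    rw [hF.near, hF.near, hrun, h1]
    rcases G i with ⟨_ | _, _ | _⟩ <;> simp [kact, kmul, sqd] <;> ring
  have hpos : (i : ℝ) + (1 - d (!σ i)) < ((i + c + 1 : ℕ) : ℝ) + (1 - d (!σ (i + c + 1))) := by
    by_contra! h
    have h3 : d (!σ i) = 0 := by
      push_cast at h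
      linarith [hdi.1, hdi.2, hdj.1, hdj.2]
    have := hF.far (!σ i)
    rw [h3, hF.start] at this
    simp at this
  have := hc.sqd_lt hlt hN (by omega) hk ⟨by linarith [hdi.2], by linarith [hdi.1]⟩
    ⟨by linarith [hdj.2], by linarith [hdj.1]⟩ hpos
  rw [e] at this
  push_cast at this
  have hcc : (c : ℝ) * (c - 1) ≥ 0 := by
    rcases Nat.eq_zero_or_pos c with h | h
    · simp [h]
    · have : (1 : ℝ) ≤ c := by exact_mod_cast h
      nlinarith
  nlinarith

/-- A straight run of cells cannot be entered after leaving a cell across the edge it was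
traversed along and left by entering a cell across such an edge. -/
theorem IsCellChain.not_run (hc : IsCellChain F M N g a G σ) (hlt : RatioLt g) (hN : N ^ 2 = M)
    (hF : IsNormal F d) {i c : ℕ} (hk : i + 1 + c + 1 < M)
    (h1 : G (i + 1) = kmul (G i) (true, true)) (h2 : ∀ m ≤ c, G (i + 1 + m) = G (i + 1))
    (h3 : G (i + 1 + c + 1) = kmul (G (i + 1)) (false, true)) : False := by
  obtain ⟨b, hb⟩ : ∃ b, IsEarly d b := by
    rcases le_total (d true) (d false) with h | h
    · exact ⟨true, h⟩
    · exact ⟨false, h⟩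
  have hl := hc.rule_left hlt hN hF hb (by omega) h1 h2
  have hr := hc.rule_right hlt hN hF hb (i := i + 1 + c) (c := 0) hk
    (by rw [add_zero, h3, h2 c le_rfl]) (fun m hm => by simp [Nat.le_zero.1 hm])
  have := hl.2.symm.trans hr.1
  simp at this

/-- The first cell that does not continue straight is entered across its edge. -/
theorem IsCellChain.exists_first (hc : IsCellChain F M N g a G σ) (hN : N ^ 2 = M) (hN2 : 2 ≤ N)
    (hF : IsNormal F d)
    (hg : ∀ t ∈ Icc (0 : ℝ) 1, (0 ≤ (g t).1 ∧ (g t).1 ≤ 1) ∧ (0 ≤ (g t).2 ∧ (g t).2 ≤ 1))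
    (hg0 : g 0 = (0, 0)) :
    ∃ k, k + 1 < M ∧ (∀ m ≤ k, G m = G 0) ∧ G (k + 1) = kmul (G 0) (false, true) := by
  have hM2 : (4 : ℝ) ≤ M := by rw [← hN]; nlinarith
  have hM4 : 4 ≤ M := by exact_mod_cast hM2
  have hM : (0 : ℝ) < M := by linarith
  have hmem : ∀ k < M, ∀ t ∈ Icc (0 : ℝ) 1, (0 ≤ (a k + kact (G k) (F (σ k) t)).1 ∧
      (a k + kact (G k) (F (σ k) t)).1 ≤ N) ∧ (0 ≤ (a k + kact (G k) (F (σ k) t)).2 ∧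
      (a k + kact (G k) (F (σ k) t)).2 ≤ N) := by
    intro k hk t ht
    rw [← hc k hk t ht]
    have hk' : (k : ℝ) + 1 ≤ M := by exact_mod_cast hk
    have := ht.1
    have := ht.2
    have := hg ((k + t) / M) ⟨by positivity, by rw [div_le_one hM]; linarith⟩
    simp only [Prod.smul_fst, Prod.smul_snd, smul_eq_mul]
    exact ⟨⟨by nlinarith [this.1.1], by nlinarith [this.1.2]⟩,
      ⟨by nlinarith [this.2.1], by nlinarith [this.2.2]⟩⟩
  have ha0 : a 0 = 0 := by
    have := hc 0 (by omega) 0 (by simp)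
    rw [hF.start] at this
    have e : kact (G 0) 0 = 0 := by
      rcases G 0 with ⟨_ | _, _ | _⟩ <;> simp [kact]
    simpa [hg0, e, Prod.mk_zero_zero] using this.symm
  have hneg : (G 0).1 = false := by
    have := hmem 0 (by omega) (d (σ 0)) (hF.mem _)
    rw [hF.far, ha0] at this
    generalize G 0 = x at this ⊢
    rcases x with ⟨_ | _, _ | _⟩ <;> simp [kact] at this ⊢ <;> linarith
  have hex : ∃ m, ¬ (m < M → G m = G 0) := by
    by_contra! hall
    have hr := hc.run hF (i := 0) (c := M - 1) (by omega)
      (fun m hm => by rw [zero_add]; exact hall m (by omega))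
    have := hmem (M - 1) (by omega) 1 (by simp)
    rw [hF.finish, hall (M - 1) (by omega), ← zero_add (M - 1), hr, ha0] at this
    rw [Nat.cast_sub (by omega), ← hN] at this
    generalize G 0 = x at this hneg
    rcases x with ⟨_ | _, _ | _⟩ <;> simp [kact] at this hneg <;> nlinarith
  classical
  have hsp := Nat.find_spec hex
  have hmin : ∀ m < Nat.find hex, m < M → G m = G 0 := fun m hm => by
    simpa using Nat.find_min hex hm
  generalize Nat.find hex = n at hsp hmin
  push Not at hsp
  obtain ⟨hnM, hn⟩ := hsp
  obtain ⟨k, rfl⟩ : ∃ k, n = k + 1 :=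
    Nat.exists_eq_succ_of_ne_zero (by rintro rfl; exact hn rfl)
  refine ⟨k, hnM, fun m hm => hmin m (by omega) (by omega), ?_⟩
  have hr := hc.run hF (i := 0) (c := k + 1) (by omega)
    (fun m hm => by rw [zero_add]; exact hmin m (by omega) (by omega))
  rw [zero_add, ha0] at hr
  have h1 := hmem (k + 1) hnM 1 (by simp)
  have h2 := hmem (k + 1) hnM (1 - d (!σ (k + 1)))
    ⟨by linarith [(hF.mem (!σ (k + 1))).2], by linarith [(hF.mem (!σ (k + 1))).1]⟩
  rw [hF.finish, hr] at h1
  rw [hF.near, hr] at h2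
  generalize G (k + 1) = y at *
  generalize G 0 = x at *
  rcases x with ⟨_ | _, _ | _⟩ <;> rcases y with ⟨_ | _, _ | _⟩ <;>
    simp [kact, kmul] at * <;> linarith

end chain

/-- The curve run backwards and reflected in the vertical axis of the square. -/
def backward (p : ℝ → ℝ × ℝ) (t : ℝ) : ℝ × ℝ := (1 - (p (1 - t)).1, (p (1 - t)).2)

/-- The curve itself and its backward version. -/
def bothWays (p : ℝ → ℝ × ℝ) (b : Bool) : ℝ → ℝ × ℝ := bif b then p else backward p

theorem bothWays_one_sub (p : ℝ → ℝ × ℝ) (b : Bool) (t : ℝ) :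
    bothWays p b (1 - t) = (1, 0) + xrefl (bothWays p (!b) t) := by
  cases b <;> ext <;> simp [bothWays, backward, xrefl]
  ring

theorem xrefl_add (v w : ℝ × ℝ) : xrefl (v + w) = xrefl v + xrefl w := by
  ext <;> simp [xrefl, add_comm]

theorem IsCellChain.backward {p : ℝ → ℝ × ℝ} {M : ℕ} {N : ℝ} {a : ℕ → ℝ × ℝ}
    {G : ℕ → Bool × Bool} {σ : ℕ → Bool} (hc : IsCellChain (bothWays p) M N p a G σ) :
    IsCellChain (bothWays p) M N (backward p)
      (fun j => (N, 0) + xrefl (a (M - 1 - j) + kact (G (M - 1 - j)) (1, 0)))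
      (fun j => kconj (G (M - 1 - j))) (fun j => !σ (M - 1 - j)) := by
  intro k hk t ht
  have hM : (M : ℝ) ≠ 0 := by
    have : M ≠ 0 := by omega
    exact_mod_cast this
  have h := hc (M - 1 - k) (by omega) (1 - t) ⟨by linarith [ht.2], by linarith [ht.1]⟩
  rw [bothWays_one_sub, kact_add] at h
  have e : (((M - 1 - k : ℕ) : ℝ) + (1 - t)) / M = 1 - (k + t) / M := by
    rw [Nat.sub_sub, Nat.cast_sub (by omega)]
    field_simp
    push_cast
    ring
  rw [e] at h
  have e2 : N • _root_.backward p ((k + t) / M) =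
      (N, 0) + xrefl (N • p (1 - (k + t) / M)) := by
    ext <;> simp [_root_.backward, xrefl]
    ring
  rw [e2, h, ← add_assoc (a _), xrefl_add, xrefl_kact_xrefl, add_assoc]

/-- Subdividing every cell gives a chain of the next level. -/
theorem IsCellChain.comp {F : Bool → ℝ → ℝ × ℝ} {M : ℕ} {N : ℝ} {g : ℝ → ℝ × ℝ} {a : ℕ → ℝ × ℝ}
    {G : ℕ → Bool × Bool} {σ : ℕ → Bool} {aa : Bool → ℕ → ℝ × ℝ} {GG : Bool → ℕ → Bool × Bool}
    {σσ : Bool → ℕ → Bool} (hc : IsCellChain F M N g a G σ)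
    (hcc : ∀ b, IsCellChain F M N (F b) (aa b) (GG b) (σσ b)) :
    IsCellChain F (M * M) (N * N) g
      (fun k => N • a (k / M) + kact (G (k / M)) (aa (σ (k / M)) (k % M)))
      (fun k => kmul (G (k / M)) (GG (σ (k / M)) (k % M)))
      (fun k => σσ (σ (k / M)) (k % M)) := by
  intro k hk t ht
  have hM0 : 0 < M := Nat.pos_of_ne_zero (by rintro rfl; simp at hk)
  have hM : (0 : ℝ) < M := by exact_mod_cast hM0
  have hq : k / M < M := Nat.div_lt_of_lt_mul hk
  have hr : k % M < M := Nat.mod_lt _ hM0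
  have hr' : ((k % M : ℕ) : ℝ) + 1 ≤ M := by exact_mod_cast hr
  have h1 := hc (k / M) hq (((k % M : ℕ) + t) / M)
    ⟨by have := ht.1; positivity, by rw [div_le_one hM]; linarith [ht.2]⟩
  have h2 := hcc (σ (k / M)) (k % M) hr t ht
  have e : (((k / M : ℕ) : ℝ) + (((k % M : ℕ) : ℝ) + t) / M) / M = (k + t) / (M * M : ℕ) := by
    have : (k : ℝ) = M * (k / M : ℕ) + (k % M : ℕ) := by exact_mod_cast (Nat.div_add_mod k M).symm
    rw [this]
    push_cast
    field_simp
    ring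
  rw [e] at h1
  rw [mul_smul, h1, smul_add, ← kact_smul, h2, kact_add, kact_kact, add_assoc]

theorem kmul_comm_assoc_cases (x y z : Bool × Bool) :
    kmul (kmul x y) z = kmul x (kmul y z) ∧ kmul x y = kmul y x ∧ kmul x (kmul x y) = y := by
  revert x y z
  decide

/-- A curve from `(0, 0)` to `(1, 0)` made of cells placed by the Klein four-group has a pair of
moments with square-to-linear ratio at least `5`. -/
theorem IsCellChain.false_of_ratioLt {p : ℝ → ℝ × ℝ} {M : ℕ} {N : ℝ} {a : ℕ → ℝ × ℝ}
    {G : ℕ → Bool × Bool} {σ : ℕ → Bool} {d : Bool → ℝ}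
    (hc : IsCellChain (bothWays p) M N p a G σ) (hlt : RatioLt p) (hN : N ^ 2 = M) (hN2 : 2 ≤ N)
    (hF : IsNormal (bothWays p) d)
    (hp : ∀ t ∈ Icc (0 : ℝ) 1, (0 ≤ (p t).1 ∧ (p t).1 ≤ 1) ∧ (0 ≤ (p t).2 ∧ (p t).2 ≤ 1)) :
    False := by
  have hM2 : (4 : ℝ) ≤ M := by rw [← hN]; nlinarith
  have hM4 : 4 ≤ M := by exact_mod_cast hM2
  have hbd : ∀ b, ∀ t ∈ Icc (0 : ℝ) 1, (0 ≤ (bothWays p b t).1 ∧ (bothWays p b t).1 ≤ 1) ∧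
      (0 ≤ (bothWays p b t).2 ∧ (bothWays p b t).2 ≤ 1) := by
    intro b t ht
    cases b
    · have := hp (1 - t) ⟨by linarith [ht.2], by linarith [ht.1]⟩
      simp only [bothWays, _root_.backward, cond_false]
      exact ⟨⟨by linarith [this.1.2], by linarith [this.1.1]⟩, this.2⟩
    · exact hp t ht
  have hchains : ∀ b, ∃ a G σ, IsCellChain (bothWays p) M N (bothWays p b) a G σ ∧
      (∃ k, k + 1 < M ∧ (∀ m ≤ k, G m = G 0) ∧ G (k + 1) = kmul (G 0) (false, true)) ∧
      ∃ k, k + 1 < M ∧ (∀ m, k + 1 ≤ m → m < M → G m = G (k + 1)) ∧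
        G (k + 1) = kmul (G k) (true, true) := by
    have hb := hc.backward
    have h1 := hc.exists_first hN hN2 hF (hbd true) (hF.start true)
    have h2 := hb.exists_first hN hN2 hF (hbd false) (hF.start false)
    have conv : ∀ x y, kconj x = kmul (kconj y) (false, true) → y = kmul x (true, true) := by
      decide
    have conv' : ∀ x y, x = kmul y (false, true) → kconj y = kmul (kconj x) (true, true) := by
      decide
    have inj : ∀ x y, kconj x = kconj y → x = y := by decide
    rintro (_ | _)
    · refine ⟨_, _, _, hb, h2, ?_⟩
      obtain ⟨k, hk, hc1, hc2⟩ := h1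
      refine ⟨M - 2 - k, by omega, fun m hm hmM => ?_, ?_⟩
      · rw [hc1 _ (by omega), hc1 (M - 1 - (M - 2 - k + 1)) (by omega)]
      · rw [show M - 1 - (M - 2 - k) = k + 1 by omega, hc1 (M - 1 - (M - 2 - k + 1)) (by omega)]
        exact conv' _ _ hc2
    · refine ⟨_, _, _, hc, h1, ?_⟩
      obtain ⟨k, hk, hc1, hc2⟩ := h2
      refine ⟨M - 2 - k, by omega, fun m hm hmM => ?_, ?_⟩
      · have e1 := hc1 (M - 1 - m) (by omega)
        have e2 := hc1 k le_rfl
        rw [show M - 1 - (M - 1 - m) = m by omega] at e1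
        rw [show M - 2 - k + 1 = M - 1 - k by omega]
        exact inj _ _ (e1.trans e2.symm)
      · rw [← hc1 k le_rfl] at hc2
        rw [show M - 2 - k + 1 = M - 1 - k by omega]
        rw [show M - 1 - (k + 1) = M - 2 - k by omega] at hc2
        exact conv _ _ hc2
  choose aa GG σσ hcc hfirst hlast using hchains
  have key : ∀ k, k + 1 < M → kmul (kmul (kmul (GG true k) (GG (σσ true k) (M - 1)))
      (kmul (GG true (k + 1)) (GG (σσ true (k + 1)) 0))) (true, false) = (false, false) := by
    intro k hk
    have h2 := (hcc true).comp hcc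
    obtain ⟨l, hl, hl1, hl2⟩ := hlast (σσ true k)
    obtain ⟨m, hm, hm1, hm2⟩ := hfirst (σσ true (k + 1))
    have hN' : (N * N) ^ 2 = (M * M : ℕ) := by
      push_cast
      rw [← hN]
      ring
    set H : ℕ → Bool × Bool := fun k => kmul (GG true (k / M)) (GG (σσ true (k / M)) (k % M))
      with hH
    have idx : ∀ q r, r < M → H (q * M + r) = kmul (GG true q) (GG (σσ true q) r) := by
      intro q r hr
      have e1 : (q * M + r) / M = q := by
        rw [mul_comm, Nat.mul_add_div (by omega), Nat.div_eq_of_lt hr, add_zero]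
      have e2 : (q * M + r) % M = r := by
        rw [mul_comm, Nat.mul_add_mod, Nat.mod_eq_of_lt hr]
      simp only [hH, e1, e2]
    have hkM : k * M + M + M ≤ M * M := by nlinarith
    have hk1 : (k + 1) * M = k * M + M := by ring
    have before : ∀ j, l + 1 ≤ j → j < M → H (k * M + j) = H (k * M + (M - 1)) := by
      intro j hj hjM
      rw [idx _ _ hjM, idx _ _ (by omega), hl1 j hj hjM, hl1 (M - 1) (by omega) (by omega)]
    have turnL : H (k * M + (M - 1)) = kmul (H (k * M + l)) (true, true) := by
      rw [idx _ _ (by omega), idx _ _ (by omega), hl1 (M - 1) (by omega) (by omega), hl2]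
      exact ((kmul_comm_assoc_cases _ _ _).1).symm
    have after : ∀ j, j ≤ m → H (k * M + M + j) = H (k * M + M) := by
      intro j hj
      have := idx (k + 1) 0 (by omega)
      rw [hk1, add_zero] at this
      rw [this, ← hk1, idx _ _ (by omega), hm1 j hj]
    have turnR : H (k * M + M + (m + 1)) = kmul (H (k * M + M)) (false, true) := by
      have := idx (k + 1) 0 (by omega)
      rw [hk1, add_zero] at this
      rw [this, ← hk1, idx _ _ (by omega), hm2]
      exact ((kmul_comm_assoc_cases _ _ _).1).symm
    have e1 := idx k (M - 1) (by omega)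
    have e2 := idx (k + 1) 0 (by omega)
    rw [hk1, add_zero] at e2
    rw [← e1, ← e2]
    generalize hx : H (k * M + (M - 1)) = x at *
    generalize hy : H (k * M + M) = y at *
    have cases4 : ∀ x y : Bool × Bool, kmul (kmul x y) (true, false) = (false, false) ∨ y = x ∨
      y = kmul x (false, true) ∨ y = kmul x (true, true) := by decide
    rcases cases4 x y with h | h | h | h
    · exact h
    · refine (h2.not_run hlt hN' hF (i := k * M + l) (c := M - l - 1 + m) (by omega) ?_ ?_ ?_).elim
      · rw [add_assoc, before (l + 1) le_rfl hl]
        exact turnL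
      · intro j hj
        rw [add_assoc (k * M) l 1, before (l + 1) le_rfl hl]
        by_cases hjl : l + 1 + j < M
        · rw [add_assoc, before _ (by omega) hjl]
        · rw [show k * M + (l + 1) + j = k * M + M + (l + 1 + j - M) by omega,
            after _ (by omega), h]
      · rw [add_assoc (k * M) l 1, before (l + 1) le_rfl hl,
          show k * M + (l + 1) + (M - l - 1 + m) + 1 = k * M + M + (m + 1) by omega, turnR, h]
    · refine (h2.not_run hlt hN' hF (i := k * M + l) (c := M - l - 2) (by omega) ?_ ?_ ?_).elim
      · rw [add_assoc, before (l + 1) le_rfl hl]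
        exact turnL
      · intro j hj
        rw [add_assoc (k * M) l 1, before (l + 1) le_rfl hl, add_assoc,
          before _ (by omega) (by omega)]
      · rw [add_assoc (k * M) l 1, before (l + 1) le_rfl hl,
          show k * M + (l + 1) + (M - l - 2) + 1 = k * M + M by omega, hy, h]
    · refine (h2.not_run hlt hN' hF (i := k * M + (M - 1)) (c := m) (by omega) ?_ ?_ ?_).elim
      · rw [show k * M + (M - 1) + 1 = k * M + M by omega, hy, hx, h]
      · intro j hj
        rw [show k * M + (M - 1) + 1 = k * M + M by omega, after j hj, hy]
      · rw [show k * M + (M - 1) + 1 = k * M + M by omega, add_assoc, turnR, hy]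
  obtain ⟨b, hb⟩ : ∃ b, IsEarly d b := by
    rcases le_total (d true) (d false) with h | h
    · exact ⟨true, h⟩
    · exact ⟨false, h⟩
  obtain ⟨k, hk, hk1, hk2⟩ := hfirst true
  obtain ⟨l, hl, hl1, hl2⟩ := hlast true
  have hk3 : GG true (k + 1) = kmul (GG true k) (false, true) := by rw [hk2, hk1 k le_rfl]
  have r1 := (hcc true).rule_right hlt hN hF hb (i := k) (c := 0) hk hk3
    (fun m hm => by simp [Nat.le_zero.1 hm])
  have r2 := (hcc true).rule_left hlt hN hF hb (i := l) (c := 0) hl hl2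
    (fun m hm => by simp [Nat.le_zero.1 hm])
  have key1 := key k hk
  have key2 := key l hl
  rw [add_zero] at r1 r2
  rw [r1.1, r1.2, hk3] at key1
  rw [r2.1, r2.2, hl2] at key2
  generalize GG true k = x at key1
  generalize GG true l = y at key2
  generalize GG b (M - 1) = u at key1 key2
  generalize GG (!b) 0 = v at key1 key2
  revert key1 key2
  revert x y u v
  decide

/-- A frame of two perpendicular unit vectors of the integer lattice. -/
def IsLatticeFrame (u w : ℤ × ℤ) : Prop :=
  u.1 ^ 2 + u.2 ^ 2 = 1 ∧ w.1 ^ 2 + w.2 ^ 2 = 1 ∧ u.1 * w.1 + u.2 * w.2 = 0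

theorem int_unit_cases {x y : ℤ} (h : x ^ 2 + y ^ 2 = 1) :
    (x = 1 ∧ y = 0) ∨ (x = -1 ∧ y = 0) ∨ (x = 0 ∧ y = 1) ∨ (x = 0 ∧ y = -1) := by
  have hx : x ≤ 1 := by nlinarith
  have hx' : -1 ≤ x := by nlinarith
  have hy : y ≤ 1 := by nlinarith
  have hy' : -1 ≤ y := by nlinarith
  interval_cases x <;> interval_cases y <;> simp_all

theorem IsLatticeFrame.cases {u w : ℤ × ℤ} (h : IsLatticeFrame u w) :
    ((u.1 = 1 ∨ u.1 = -1) ∧ u.2 = 0 ∧ w.1 = 0 ∧ (w.2 = 1 ∨ w.2 = -1)) ∨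
      (u.1 = 0 ∧ (u.2 = 1 ∨ u.2 = -1) ∧ (w.1 = 1 ∨ w.1 = -1) ∧ w.2 = 0) := by
  obtain ⟨u1, u2⟩ := u
  obtain ⟨w1, w2⟩ := w
  obtain ⟨h1, h2, h3⟩ := h
  simp only at h1 h2 h3
  rcases int_unit_cases h1 with ⟨rfl, rfl⟩ | ⟨rfl, rfl⟩ | ⟨rfl, rfl⟩ | ⟨rfl, rfl⟩ <;>
    rcases int_unit_cases h2 with ⟨rfl, rfl⟩ | ⟨rfl, rfl⟩ | ⟨rfl, rfl⟩ | ⟨rfl, rfl⟩ <;>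
    simp_all

/-- The curve `p` maps `[0, 1]` onto the unit square, and its pieces `[k / N², (k + 1) / N²]` fill
different cells of the `N × N` grid by similar copies of `p`: in the frame `o k; u k, w k`, forwards
or backwards according to `σ k`. -/
structure IsGridCurve (N : ℕ) (p : ℝ → ℝ × ℝ) (o u w : ℕ → ℤ × ℤ) (σ : ℕ → Bool) : Prop where
  two_le : 2 ≤ N
  mem : ∀ t ∈ Icc (0 : ℝ) 1, (0 ≤ (p t).1 ∧ (p t).1 ≤ 1) ∧ (0 ≤ (p t).2 ∧ (p t).2 ≤ 1)
  visits : ∀ x ∈ Icc (0 : ℝ) 1, ∀ y ∈ Icc (0 : ℝ) 1, ∃ t ∈ Icc (0 : ℝ) 1, p t = (x, y)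
  frame : ∀ k < N ^ 2, IsLatticeFrame (u k) (w k)
  cell_fst : ∀ k < N ^ 2, ∀ t ∈ Icc (0 : ℝ) 1, N * (p ((k + t) / (N ^ 2 : ℕ))).1 =
    (o k).1 + (p (bif σ k then t else 1 - t)).1 * (u k).1 +
      (p (bif σ k then t else 1 - t)).2 * (w k).1
  cell_snd : ∀ k < N ^ 2, ∀ t ∈ Icc (0 : ℝ) 1, N * (p ((k + t) / (N ^ 2 : ℕ))).2 =
    (o k).2 + (p (bif σ k then t else 1 - t)).1 * (u k).2 +
      (p (bif σ k then t else 1 - t)).2 * (w k).2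
  inj : ∀ k < N ^ 2, ∀ l < N ^ 2, 2 * (o k).1 + (u k).1 + (w k).1 = 2 * (o l).1 + (u l).1 + (w l).1 →
    2 * (o k).2 + (u k).2 + (w k).2 = 2 * (o l).2 + (u l).2 + (w l).2 → k = l

theorem IsLatticeFrame.swap {u w : ℤ × ℤ} (h : IsLatticeFrame u w) :
    IsLatticeFrame w.swap u.swap := by
  obtain ⟨h1, h2, h3⟩ := h
  exact ⟨by simp; linarith, by simp; linarith, by simp; linarith⟩

section grid

variable {N : ℕ} {p : ℝ → ℝ × ℝ} {o u w : ℕ → ℤ × ℤ} {σ : ℕ → Bool}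

theorem IsGridCurve.swap (h : IsGridCurve N p o u w σ) :
    IsGridCurve N (fun t => (p t).swap) (fun k => (o k).swap) (fun k => (w k).swap)
      (fun k => (u k).swap) σ where
  two_le := h.two_le
  mem t ht := (h.mem t ht).symm
  visits x hx y hy := by
    obtain ⟨t, ht, e⟩ := h.visits y hy x hx
    exact ⟨t, ht, by simp [e]⟩
  frame k hk := (h.frame k hk).swap
  cell_fst k hk t ht := by
    simpa [add_right_comm] using h.cell_snd k hk t ht
  cell_snd k hk t ht := by
    simpa [add_right_comm] using h.cell_fst k hk t ht
  inj k hk l hl h1 h2 := h.inj k hk l hl (by simp at h2; linarith) (by simp at h1; linarith)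

theorem IsGridCurve.flip (h : IsGridCurve N p o u w σ) :
    IsGridCurve N (fun t => (1 - (p t).1, (p t).2)) (fun k => (N - (o k).1 - (u k).1, (o k).2 + (u k).2))
      (fun k => ((u k).1, -(u k).2)) (fun k => (-(w k).1, (w k).2)) σ where
  two_le := h.two_le
  mem t ht := by
    have := h.mem t ht
    exact ⟨⟨by linarith [this.1.2], by linarith [this.1.1]⟩, this.2⟩
  visits x hx y hy := by
    obtain ⟨t, ht, e⟩ := h.visits (1 - x) ⟨by linarith [hx.2], by linarith [hx.1]⟩ y hy
    exact ⟨t, ht, by simp [e]⟩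
  frame k hk := by
    obtain ⟨h1, h2, h3⟩ := h.frame k hk
    exact ⟨by simpa using h1, by simpa using h2, by simp; linarith⟩
  cell_fst k hk t ht := by
    have := h.cell_fst k hk t ht
    push_cast
    push_cast at this
    linear_combination -this
  cell_snd k hk t ht := by
    have := h.cell_snd k hk t ht
    push_cast
    push_cast at this
    linear_combination this
  inj k hk l hl h1 h2 := h.inj k hk l hl (by simp only at h1; linarith) (by simp only at h2; linarith)

theorem IsGridCurve.sq_pos (h : IsGridCurve N p o u w σ) : 4 ≤ N ^ 2 := by
  have := h.two_le
  nlinarith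

/-- The double center of a cell lies in the magnified square. -/
theorem IsGridCurve.center_mem (h : IsGridCurve N p o u w σ) {k : ℕ} (hk : k < N ^ 2) :
    (1 ≤ 2 * (o k).1 + (u k).1 + (w k).1 ∧ 2 * (o k).1 + (u k).1 + (w k).1 ≤ 2 * N - 1) ∧
      (1 ≤ 2 * (o k).2 + (u k).2 + (w k).2 ∧ 2 * (o k).2 + (u k).2 + (w k).2 ≤ 2 * N - 1) := by
  have hM : (0 : ℝ) < (N ^ 2 : ℕ) := by exact_mod_cast (Nat.zero_le k).trans_lt hk
  have hk' : (k : ℝ) + 1 ≤ (N ^ 2 : ℕ) := by exact_mod_cast hk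
  have key : ∀ x y : ℤ, (0 ≤ x ∧ x ≤ 1) → (0 ≤ y ∧ y ≤ 1) →
      (0 ≤ (o k).1 + x * (u k).1 + y * (w k).1 ∧ (o k).1 + x * (u k).1 + y * (w k).1 ≤ N) ∧
      (0 ≤ (o k).2 + x * (u k).2 + y * (w k).2 ∧ (o k).2 + x * (u k).2 + y * (w k).2 ≤ N) := by
    intro x y hx hy
    obtain ⟨t, ht, e⟩ := h.visits x ⟨by exact_mod_cast hx.1, by exact_mod_cast hx.2⟩ y
      ⟨by exact_mod_cast hy.1, by exact_mod_cast hy.2⟩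
    have hτ : (bif σ k then t else 1 - t) ∈ Icc (0 : ℝ) 1 := by
      cases σ k
      · exact ⟨by simpa using ht.2, by simpa using ht.1⟩
      · exact ht
    have h1 := h.cell_fst k hk _ hτ
    have h2 := h.cell_snd k hk _ hτ
    have e2 : (bif σ k then (bif σ k then t else 1 - t) else 1 - (bif σ k then t else 1 - t)) = t := by
      cases σ k <;> simp
    rw [e2, e] at h1 h2
    simp only at h1 h2
    have hm := h.mem ((k + (bif σ k then t else 1 - t)) / (N ^ 2 : ℕ))
      ⟨by have := hτ.1; positivity, by rw [div_le_one hM]; linarith [hτ.2]⟩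
    have hN : (0 : ℝ) ≤ N := by positivity
    refine ⟨⟨?_, ?_⟩, ⟨?_, ?_⟩⟩
    · have := mul_nonneg hN hm.1.1
      rw [h1] at this
      exact_mod_cast this
    · have := mul_le_mul_of_nonneg_left hm.1.2 hN
      rw [h1, mul_one] at this
      exact_mod_cast this
    · have := mul_nonneg hN hm.2.1
      rw [h2] at this
      exact_mod_cast this
    · have := mul_le_mul_of_nonneg_left hm.2.2 hN
      rw [h2, mul_one] at this
      exact_mod_cast this
  have k00 := key 0 0 (by norm_num) (by norm_num)
  have k01 := key 0 1 (by norm_num) (by norm_num)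
  have k10 := key 1 0 (by norm_num) (by norm_num)
  have k11 := key 1 1 (by norm_num) (by norm_num)
  have := (h.frame k hk).cases
  omega

/-- A point of a cell is at distance at most one half from its center, in each coordinate. -/
theorem IsLatticeFrame.abs_sub_le {u w : ℤ × ℤ} (h : IsLatticeFrame u w) {x y : ℝ}
    (hx : x ∈ Icc (0 : ℝ) 1) (hy : y ∈ Icc (0 : ℝ) 1) :
    |2 * (x * u.1 + y * w.1) - (u.1 + w.1)| ≤ 1 ∧ |2 * (x * u.2 + y * w.2) - (u.2 + w.2)| ≤ 1 := by
  obtain ⟨hx0, hx1⟩ := hx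
  obtain ⟨hy0, hy1⟩ := hy
  rcases h.cases with ⟨h1 | h1, h2, h3, h4 | h4⟩ | ⟨h1, h2 | h2, h3 | h3, h4⟩ <;>
    rw [h1, h2, h3, h4] <;> simp only [abs_le] <;> push_cast <;>
    exact ⟨⟨by linarith, by linarith⟩, ⟨by linarith, by linarith⟩⟩

/-- Two frames whose cells share an interior point `o + α u` of the edge `[o, o + u]` of one of
them: the cells coincide or are neighbours across the edge. -/
theorem IsLatticeFrame.neighbour {o u w o' u' w' : ℤ × ℤ} (h : IsLatticeFrame u w)
    (h' : IsLatticeFrame u' w') {α x y : ℝ} (h0 : 0 < α) (h1 : α < 1) (hx : x ∈ Icc (0 : ℝ) 1)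
    (hy : y ∈ Icc (0 : ℝ) 1) (e1 : (o.1 + α * u.1 : ℝ) = o'.1 + x * u'.1 + y * w'.1)
    (e2 : (o.2 + α * u.2 : ℝ) = o'.2 + x * u'.2 + y * w'.2)
    (hne : ¬ (2 * o.1 + u.1 + w.1 = 2 * o'.1 + u'.1 + w'.1 ∧
      2 * o.2 + u.2 + w.2 = 2 * o'.2 + u'.2 + w'.2)) :
    2 * o'.1 + u'.1 + w'.1 = 2 * o.1 + u.1 - w.1 ∧
      2 * o'.2 + u'.2 + w'.2 = 2 * o.2 + u.2 - w.2 := by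
  obtain ⟨b1, b2⟩ := h'.abs_sub_le hx hy
  have p1 : ∃ m : ℤ, 2 * o'.1 + u'.1 + w'.1 = 2 * m + 1 :=
    ⟨(2 * o'.1 + u'.1 + w'.1) / 2, by have := h'.cases; omega⟩
  have p2 : ∃ m : ℤ, 2 * o'.2 + u'.2 + w'.2 = 2 * m + 1 :=
    ⟨(2 * o'.2 + u'.2 + w'.2) / 2, by have := h'.cases; omega⟩
  obtain ⟨m1, p1⟩ := p1
  obtain ⟨m2, p2⟩ := p2
  have q1 : (2 * o'.1 + u'.1 + w'.1 : ℝ) = 2 * m1 + 1 := by exact_mod_cast p1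
  have q2 : (2 * o'.2 + u'.2 + w'.2 : ℝ) = 2 * m2 + 1 := by exact_mod_cast p2
  rw [abs_le] at b1 b2
  have c1 : 2 * (m1 : ℝ) ≤ 2 * (o.1 + α * u.1) := by linarith
  have c2 : 2 * (o.1 + α * u.1) ≤ 2 * (m1 : ℝ) + 2 := by linarith
  have c3 : 2 * (m2 : ℝ) ≤ 2 * (o.2 + α * u.2) := by linarith
  have c4 : 2 * (o.2 + α * u.2) ≤ 2 * (m2 : ℝ) + 2 := by linarith
  rw [p1, p2] at hne ⊢
  clear b1 b2 q1 q2 p1 p2 e1 e2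
  have lt_of : ∀ m n : ℤ, (m : ℝ) < n → m < n := fun m n h => by exact_mod_cast h
  have le_of : ∀ m n : ℤ, (m : ℝ) ≤ n → m ≤ n := fun m n h => by exact_mod_cast h
  rcases h.cases with ⟨r1 | r1, r2, r3, r4⟩ | ⟨r1, r2 | r2, r3, r4⟩ <;>
    simp only [r1, r2] at c1 c2 c3 c4 <;> push_cast at c1 c2 c3 c4
  · have d1 := lt_of m1 (o.1 + 1) (by push_cast; linarith)
    have d2 := lt_of o.1 (m1 + 1) (by push_cast; linarith)
    have d3 := le_of m2 o.2 (by linarith)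
    have d4 := le_of o.2 (m2 + 1) (by push_cast; linarith)
    omega
  · have d1 := lt_of m1 o.1 (by linarith)
    have d2 := lt_of (o.1 - 1) (m1 + 1) (by push_cast; linarith)
    have d3 := le_of m2 o.2 (by linarith)
    have d4 := le_of o.2 (m2 + 1) (by push_cast; linarith)
    omega
  · have d1 := lt_of m2 (o.2 + 1) (by push_cast; linarith)
    have d2 := lt_of o.2 (m2 + 1) (by push_cast; linarith)
    have d3 := le_of m1 o.1 (by linarith)
    have d4 := le_of o.1 (m1 + 1) (by push_cast; linarith)
    omega
  · have d1 := lt_of m2 o.2 (by linarith)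
    have d2 := lt_of (o.2 - 1) (m2 + 1) (by push_cast; linarith)
    have d3 := le_of m1 o.1 (by linarith)
    have d4 := le_of o.1 (m1 + 1) (by push_cast; linarith)
    omega

theorem IsLatticeFrame.not_lattice {o u w P : ℤ × ℤ} (h : IsLatticeFrame u w) {α : ℝ}
    (h0 : 0 < α) (h1 : α < 1) (e1 : (o.1 + α * u.1 : ℝ) = P.1) (e2 : (o.2 + α * u.2 : ℝ) = P.2) :
    False := by
  have key : ∀ m : ℤ, α ≠ m := by
    rintro m rfl
    have a1 : 0 < m := by exact_mod_cast h0
    have a2 : m < 1 := by exact_mod_cast h1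
    omega
  rcases int_unit_cases h.1 with ⟨h, h'⟩ | ⟨h, h'⟩ | ⟨h, h'⟩ | ⟨h, h'⟩ <;> rw [h] at e1 <;>
    rw [h'] at e2
  · exact key (P.1 - o.1) (by push_cast at *; linarith)
  · exact key (o.1 - P.1) (by push_cast at *; linarith)
  · exact key (P.2 - o.2) (by push_cast at *; linarith)
  · exact key (o.2 - P.2) (by push_cast at *; linarith)

/-- An edge starting at a corner of the square has no cell on the other side. -/
theorem IsGridCurve.corner (h : IsGridCurve N p o u w σ) {k l : ℕ} (hk : k < N ^ 2) (hl : l < N ^ 2)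
    {c c' : ℤ} (hc : c = 0 ∨ c = 1) (hc' : c' = 0 ∨ c' = N) (e1 : (o k).1 + c * (u k).1 = c')
    (e2 : (o k).2 + c * (u k).2 = 0)
    (hz : 2 * (o l).1 + (u l).1 + (w l).1 = 2 * (o k).1 + (u k).1 - (w k).1 ∧
      2 * (o l).2 + (u l).2 + (w l).2 = 2 * (o k).2 + (u k).2 - (w k).2) : False := by
  have z1 := h.center_mem hk
  have z2 := h.center_mem hl
  rw [hz.1, hz.2] at z2
  have := (h.frame k hk).cases
  rcases hc with rfl | rfl <;> rcases hc' with rfl | rfl <;> omega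

/-- If both ends of the curve are on the lower side of the square, they are its two vertices. -/
theorem IsGridCurve.ends (h : IsGridCurve N p o u w σ) (h0 : (p 0).2 = 0) (h1 : (p 1).2 = 0) :
    (p 0 = (0, 0) ∧ p 1 = (1, 0)) ∨ (p 0 = (1, 0) ∧ p 1 = (0, 0)) := by
  have hM4 := h.sq_pos
  have hM : ((N ^ 2 : ℕ) : ℝ) ≠ 0 := by
    have : N ^ 2 ≠ 0 := by omega
    exact_mod_cast this
  have hN0 : 0 < N := by linarith [h.two_le]
  have entry : ∀ k < N ^ 2,
      N * (p (k / (N ^ 2 : ℕ))).1 = (o k).1 + (bif σ k then (p 0).1 else (p 1).1) * (u k).1 ∧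
      N * (p (k / (N ^ 2 : ℕ))).2 = (o k).2 + (bif σ k then (p 0).1 else (p 1).1) * (u k).2 := by
    intro k hk
    have e1 := h.cell_fst k hk 0 (by simp)
    have e2 := h.cell_snd k hk 0 (by simp)
    rw [add_zero] at e1 e2
    rw [e1, e2]
    cases σ k <;> simp [h0, h1]
  have exit : ∀ k < N ^ 2, N * (p ((k + 1 : ℕ) / (N ^ 2 : ℕ))).1 =
        (o k).1 + (bif σ k then (p 1).1 else (p 0).1) * (u k).1 ∧
      N * (p ((k + 1 : ℕ) / (N ^ 2 : ℕ))).2 =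
        (o k).2 + (bif σ k then (p 1).1 else (p 0).1) * (u k).2 := by
    intro k hk
    have e1 := h.cell_fst k hk 1 (by simp)
    have e2 := h.cell_snd k hk 1 (by simp)
    rw [Nat.cast_succ, e1, e2]
    cases σ k <;> simp [h0, h1]
  have m0 := (h.mem 0 (by simp)).1
  have m1 := (h.mem 1 (by simp)).1
  have hne : ∀ k < N ^ 2, ∀ l < N ^ 2, k ≠ l →
      ¬ (2 * (o k).1 + (u k).1 + (w k).1 = 2 * (o l).1 + (u l).1 + (w l).1 ∧
      2 * (o k).2 + (u k).2 + (w k).2 = 2 * (o l).2 + (u l).2 + (w l).2) :=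
    fun k hk l hl hkl hz => hkl (h.inj k hk l hl hz.1 hz.2)
  have zero_mem : (0 : ℝ) ∈ Icc (0 : ℝ) 1 := by simp
  have hmem : ∀ b : Bool, (bif b then (p 0).1 else (p 1).1) ∈ Icc (0 : ℝ) 1 ∧
      (bif b then (p 1).1 else (p 0).1) ∈ Icc (0 : ℝ) 1 := by
    rintro (_ | _)
    exacts [⟨m1, m0⟩, ⟨m0, m1⟩]
  have next : ∀ k, k + 1 < N ^ 2 → 0 < (bif σ k then (p 1).1 else (p 0).1) →
      (bif σ k then (p 1).1 else (p 0).1) < 1 →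
      2 * (o (k + 1)).1 + (u (k + 1)).1 + (w (k + 1)).1 = 2 * (o k).1 + (u k).1 - (w k).1 ∧
      2 * (o (k + 1)).2 + (u (k + 1)).2 + (w (k + 1)).2 = 2 * (o k).2 + (u k).2 - (w k).2 := by
    intro k hk hp0 hp1
    have ex := exit k (by omega)
    have en := entry (k + 1) hk
    refine (h.frame k (by omega)).neighbour (h.frame (k + 1) hk) hp0 hp1 (hmem (σ (k + 1))).1
      zero_mem ?_ ?_ (hne _ (by omega) _ hk (by omega))
    · linarith [ex.1, en.1]
    · linarith [ex.2, en.2]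
  have prev : ∀ k, k + 1 < N ^ 2 → 0 < (bif σ (k + 1) then (p 0).1 else (p 1).1) →
      (bif σ (k + 1) then (p 0).1 else (p 1).1) < 1 →
      2 * (o k).1 + (u k).1 + (w k).1 = 2 * (o (k + 1)).1 + (u (k + 1)).1 - (w (k + 1)).1 ∧
      2 * (o k).2 + (u k).2 + (w k).2 = 2 * (o (k + 1)).2 + (u (k + 1)).2 - (w (k + 1)).2 := by
    intro k hk hp0 hp1
    have ex := exit k (by omega)
    have en := entry (k + 1) hk
    refine (h.frame (k + 1) hk).neighbour (h.frame k (by omega)) hp0 hp1 (hmem (σ k)).2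
      zero_mem ?_ ?_ (hne _ hk _ (by omega) (by omega))
    · linarith [ex.1, en.1]
    · linarith [ex.2, en.2]
  have start0 := entry 0 (by omega)
  rw [Nat.cast_zero, zero_div, h0] at start0
  have exit_end := exit (N ^ 2 - 1) (by omega)
  rw [Nat.sub_add_cancel (by omega), div_self hM, h1] at exit_end
  have vertex : ∀ x : ℝ, 0 ≤ x ∧ x ≤ 1 → (0 < x ∧ x < 1) ∨ x = 0 ∨ x = 1 := by
    intro x hx
    rcases hx.1.eq_or_lt with h | h
    · exact Or.inr (Or.inl h.symm)
    · rcases hx.2.eq_or_lt with h' | h'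
      · exact Or.inr (Or.inr h')
      · exact Or.inl ⟨h, h'⟩
  have toInt : ∀ x : ℝ, x = 0 ∨ x = 1 → ∃ c c' : ℤ, (c = 0 ∨ c = 1) ∧ (c' = 0 ∨ c' = N) ∧
      x = c ∧ (N : ℝ) * x = c' := by
    rintro x (rfl | rfl)
    · exact ⟨0, 0, by simp⟩
    · exact ⟨1, N, by simp⟩
  rcases vertex _ m0 with ha | ha <;> rcases vertex _ m1 with hb | hb
  · exfalso
    have hin : ∀ b : Bool, (0 < (bif b then (p 0).1 else (p 1).1) ∧
        (bif b then (p 0).1 else (p 1).1) < 1) ∧ 0 < (bif b then (p 1).1 else (p 0).1) ∧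
        (bif b then (p 1).1 else (p 0).1) < 1 := by
      rintro (_ | _)
      exacts [⟨hb, ha⟩, ⟨ha, hb⟩]
    have z0 := prev 0 (by omega) (hin _).1.1 (hin _).1.2
    have z2 := next 1 (by omega) (hin _).2.1 (hin _).2.2
    exact hne 0 (by omega) (1 + 1) (by omega) (by omega) ⟨z0.1.trans z2.1.symm, z0.2.trans z2.2.symm⟩
  · exfalso
    obtain ⟨c, c', hc, hc', ec, ec'⟩ := toInt _ hb
    have hs : σ (N ^ 2 - 1) = true := by
      by_contra hs
      rw [Bool.not_eq_true] at hs
      rw [hs, cond_false, ec'] at exit_end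
      exact (h.frame (N ^ 2 - 1) (by omega)).not_lattice (P := (c', 0)) ha.1 ha.2 exit_end.1.symm
        (by rw [← exit_end.2]; simp)
    obtain ⟨k, hk⟩ : ∃ k, N ^ 2 - 1 = k + 1 := ⟨N ^ 2 - 2, by omega⟩
    rw [hk] at hs exit_end
    rw [hs, cond_true, ec', ec] at exit_end
    have z := prev k (by omega) (by rw [hs]; exact ha.1) (by rw [hs]; exact ha.2)
    refine h.corner (by omega) (by omega) hc hc' ?_ ?_ z
    · exact_mod_cast exit_end.1.symm
    · rw [mul_zero] at exit_end
      exact_mod_cast exit_end.2.symm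
  · exfalso
    obtain ⟨c, c', hc, hc', ec, ec'⟩ := toInt _ ha
    have hs : σ 0 = true := by
      by_contra hs
      rw [Bool.not_eq_true] at hs
      rw [hs, cond_false, ec'] at start0
      exact (h.frame 0 (by omega)).not_lattice (P := (c', 0)) hb.1 hb.2 start0.1.symm
        (by rw [← start0.2]; simp)
    rw [hs, cond_true, ec', ec] at start0
    have z := next 0 (by omega) (by rw [hs]; exact hb.1) (by rw [hs]; exact hb.2)
    refine h.corner (by omega) (by omega) hc hc' ?_ ?_ z
    · exact_mod_cast start0.1.symm
    · rw [mul_zero] at start0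
      exact_mod_cast start0.2.symm
  · have hab : (p 0).1 ≠ (p 1).1 := by
      intro hab
      have ex := exit 0 (by omega)
      have en := entry 1 (by omega)
      obtain ⟨c, c', hc, hc', ec, ec'⟩ := toInt _ ha
      rw [zero_add] at ex
      rw [en.1, en.2, ← hab, ec] at ex
      rw [ec', ← hab, ec] at start0
      simp only [Bool.cond_self] at ex start0
      have e1 : c' = (o 0).1 + c * (u 0).1 := by exact_mod_cast start0.1
      have e2 : 0 = (o 0).2 + c * (u 0).2 := by
        rw [mul_zero] at start0
        exact_mod_cast start0.2
      have e3 : (o 1).1 + c * (u 1).1 = (o 0).1 + c * (u 0).1 := by exact_mod_cast ex.1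
      have e4 : (o 1).2 + c * (u 1).2 = (o 0).2 + c * (u 0).2 := by exact_mod_cast ex.2
      have z0 := h.center_mem (k := 0) (by omega)
      have z1 := h.center_mem (k := 1) (by omega)
      refine hne 0 (by omega) 1 (by omega) (by omega) ?_
      have f0 := (h.frame 0 (by omega)).cases
      have f1 := (h.frame 1 (by omega)).cases
      rcases hc with rfl | rfl <;> rcases hc' with rfl | rfl <;> omega
    have pair : ∀ t x, (p t).1 = x → (p t).2 = 0 → p t = (x, 0) := fun t x h h' => by
      rw [← h, ← h']
    rcases ha with ha | ha <;> rcases hb with hb | hb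
    · exact absurd (ha.trans hb.symm) hab
    · exact Or.inl ⟨pair _ _ ha h0, pair _ _ hb h1⟩
    · exact Or.inr ⟨pair _ _ ha h0, pair _ _ hb h1⟩
    · exact absurd (ha.trans hb.symm) hab

end grid

theorem RatioLt.backward {p : ℝ → ℝ × ℝ} (h : RatioLt p) : RatioLt (backward p) := by
  intro t ht t' ht' htt
  have := h (1 - t') ⟨by linarith [ht'.2], by linarith [ht'.1]⟩ (1 - t)
    ⟨by linarith [ht.2], by linarith [ht.1]⟩ (by linarith)
  simp only [sqd, _root_.backward] at *
  linarith

theorem RatioLt.swap {p : ℝ → ℝ × ℝ} (h : RatioLt p) : RatioLt (fun t => (p t).swap) := by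
  intro t ht t' ht' htt
  have := h t ht t' ht' htt
  simp only [sqd, Prod.fst_swap, Prod.snd_swap] at *
  linarith

theorem RatioLt.flip {p : ℝ → ℝ × ℝ} (h : RatioLt p) :
    RatioLt (fun t => (1 - (p t).1, (p t).2)) := by
  intro t ht t' ht' htt
  have := h t ht t' ht' htt
  simp only [sqd] at *
  linarith

/-- The element of the Klein four-group that maps `(1, 0)` to the unit lattice vector `e`. -/
def kleinOf (e : ℤ × ℤ) : Bool × Bool := (decide (e.1 + e.2 < 0), decide (e.1 = 0))

theorem kact_kleinOf {e w : ℤ × ℤ} (he : e.1 ^ 2 + e.2 ^ 2 = 1) (hw : w = e.swap) (v : ℝ × ℝ) :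
    kact (kleinOf e) v = (v.1 * e.1 + v.2 * w.1, v.1 * e.2 + v.2 * w.2) := by
  obtain ⟨e1, e2⟩ := e
  subst hw
  rcases int_unit_cases he with ⟨h1, h2⟩ | ⟨h1, h2⟩ | ⟨h1, h2⟩ | ⟨h1, h2⟩ <;> simp only at h1 h2 <;>
    subst h1 h2 <;> ext <;> simp [kact, kleinOf]

theorem IsLatticeFrame.neg_left {u w : ℤ × ℤ} (h : IsLatticeFrame u w) :
    IsLatticeFrame (-u) w := by
  obtain ⟨h1, h2, h3⟩ := h
  exact ⟨by simpa using h1, h2, by simp; linarith⟩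

section grid

variable {N : ℕ} {p : ℝ → ℝ × ℝ} {o u w : ℕ → ℤ × ℤ} {σ : ℕ → Bool}

theorem exists_isNormal {p : ℝ → ℝ × ℝ} (h0 : p 0 = (0, 0)) (h1 : p 1 = (1, 0))
    (hC : ∃ t ∈ Icc (0 : ℝ) 1, p t = (0, 1)) (hD : ∃ t ∈ Icc (0 : ℝ) 1, p t = (1, 1)) :
    ∃ d, IsNormal (bothWays p) d := by
  obtain ⟨c, hc, ec⟩ := hC
  obtain ⟨d, hd, ed⟩ := hD
  refine ⟨fun b => bif b then d else 1 - c, ?_, ?_, ?_, ?_, ?_⟩ <;> rintro (_ | _) <;>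
    simp [bothWays, backward, *]
  exact ⟨hc.2, hc.1⟩

/-- Consecutive cells of a normalized grid curve have a common side; equivalently, the frames of
all cells, taken in the direction of the motion, are symmetric. -/
theorem IsGridCurve.frame_symm (h : IsGridCurve N p o u w σ) (hlt : RatioLt p) (h0 : p 0 = (0, 0))
    {d : Bool → ℝ} (hF : IsNormal (bothWays p) d)
    {a e : ℕ → ℤ × ℤ} (he : ∀ k, e k = bif σ k then u k else -u k)
    (ha : ∀ k, a k = bif σ k then o k else o k + u k)
    (hc : ∀ k < N ^ 2, ∀ t ∈ Icc (0 : ℝ) 1, (N : ℝ) • p ((k + t) / (N ^ 2 : ℕ)) =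
      ((a k).1 + (bothWays p (σ k) t).1 * (e k).1 + (bothWays p (σ k) t).2 * (w k).1,
        (a k).2 + (bothWays p (σ k) t).1 * (e k).2 + (bothWays p (σ k) t).2 * (w k).2)) :
    ∀ k < N ^ 2, w k = (e k).swap := by
  have hfr : ∀ k < N ^ 2, IsLatticeFrame (e k) (w k) := by
    intro k hk
    rw [he]
    cases σ k
    · exact (h.frame k hk).neg_left
    · exact h.frame k hk
  have hz : ∀ k, 2 * (o k).1 + (u k).1 = 2 * (a k).1 + (e k).1 ∧
      2 * (o k).2 + (u k).2 = 2 * (a k).2 + (e k).2 := by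
    intro k
    rw [ha, he]
    cases σ k <;> simp <;> constructor <;> ring
  intro k
  induction k with
  | zero =>
    intro hk
    have z := h.center_mem hk
    rw [(hz 0).1, (hz 0).2] at z
    have hs := hc 0 hk 0 (by simp)
    rw [hF.start] at hs
    have e1 : (a 0).1 = 0 := by
      have := congrArg Prod.fst hs
      simp [h0] at this
      exact_mod_cast this.symm
    have e2 : (a 0).2 = 0 := by
      have := congrArg Prod.snd hs
      simp [h0] at this
      exact_mod_cast this.symm
    have f := (hfr 0 hk).cases
    ext
    · simp only [Prod.fst_swap]
      omega
    · simp only [Prod.snd_swap]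
      omega
  | succ k ih =>
    intro hk
    have hw := ih (by omega)
    have f := (hfr k (by omega)).cases
    have f' := (hfr (k + 1) hk).cases
    have hend := hc k (by omega) 1 (by simp)
    have hstart := hc (k + 1) hk 0 (by simp)
    rw [hF.finish] at hend
    rw [hF.start, Nat.cast_succ, add_zero, hend] at hstart
    have s1 : (a k).1 + (e k).1 = (a (k + 1)).1 := by
      have := congrArg Prod.fst hstart
      simp at this
      exact_mod_cast this
    have s2 : (a k).2 + (e k).2 = (a (k + 1)).2 := by
      have := congrArg Prod.snd hstart
      simp at this
      exact_mod_cast this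
    by_contra hne
    have hne' : ¬ ((w (k + 1)).1 = (e (k + 1)).2 ∧ (w (k + 1)).2 = (e (k + 1)).1) := by
      intro h'
      exact hne (Prod.ext h'.1 h'.2)
    have hdist : ¬ (2 * (a k).1 + (e k).1 + (w k).1 =
        2 * (a (k + 1)).1 + (e (k + 1)).1 + (w (k + 1)).1 ∧
        2 * (a k).2 + (e k).2 + (w k).2 =
        2 * (a (k + 1)).2 + (e (k + 1)).2 + (w (k + 1)).2) := by
      rintro ⟨z1, z2⟩
      have := h.inj k (by omega) (k + 1) hk (by rw [(hz k).1, (hz (k + 1)).1, z1])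
        (by rw [(hz k).2, (hz (k + 1)).2, z2])
      omega
    have w1 : (w k).1 = (e k).2 := by rw [hw, Prod.fst_swap]
    have w2 : (w k).2 = (e k).1 := by rw [hw, Prod.snd_swap]
    have opp : (e (k + 1)).1 + (w (k + 1)).1 = (e k).1 - (w k).1 ∧
        (e (k + 1)).2 + (w (k + 1)).2 = (e k).2 - (w k).2 := by
      omega
    have hltb : ∀ b, RatioLt (bothWays p b) := by
      rintro (_ | _)
      · exact hlt.backward
      · exact hlt
    -- the corner opposite to the common vertex, in each of the two cells
    obtain ⟨hc0, hc1⟩ := hF.mem (!σ k)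
    obtain ⟨hd0, hd1⟩ := hF.mem (σ (k + 1))
    have hcpos : 0 < 1 - d (!σ k) := by
      rcases hc1.lt_or_eq with h' | h'
      · linarith
      · have := hF.far (!σ k)
        rw [h', hF.finish] at this
        simp at this
    have hdpos : d (σ (k + 1)) < 1 := by
      rcases hd1.lt_or_eq with h' | h'
      · exact h'
      · have := hF.far (σ (k + 1))
        rw [h', hF.finish] at this
        simp at this
    have hdpos' : 0 < d (σ (k + 1)) := by
      rcases hd0.lt_or_eq with h' | h'
      · exact h'
      · have := hF.far (σ (k + 1))
        rw [← h', hF.start] at this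
        simp at this
    have b1 := hltb (σ k) 0 (by simp) (1 - d (!σ k)) ⟨hcpos.le, by linarith⟩ hcpos
    have b2 := hltb (σ (k + 1)) (d (σ (k + 1))) ⟨hd0, hd1⟩ 1 (by simp) hdpos
    rw [hF.near, hF.start] at b1
    rw [hF.far, hF.finish] at b2
    simp [sqd] at b1 b2
    have key := hlt.scaled (M := N ^ 2) (N := N) (by push_cast; ring) (i := k) (j := k + 1)
      (t := 1 - d (!σ k)) (t' := d (σ (k + 1))) (by omega) hk ⟨hcpos.le, by linarith⟩
      ⟨hd0, hd1⟩ (by push_cast; linarith)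
    rw [hc k (by omega) _ ⟨hcpos.le, by linarith⟩, hc (k + 1) hk _ ⟨hd0, hd1⟩, hF.near, hF.far]
      at key
    have sq8 : (2 * ((e k).1 : ℝ) - 2 * (w k).1) ^ 2 + (2 * ((e k).2 : ℝ) - 2 * (w k).2) ^ 2 = 8 := by
      have f := hfr k (by omega)
      have f1 : ((e k).1 : ℝ) ^ 2 + (e k).2 ^ 2 = 1 := by exact_mod_cast f.1
      have f2 : ((w k).1 : ℝ) ^ 2 + (w k).2 ^ 2 = 1 := by exact_mod_cast f.2.1
      have f3 : ((e k).1 : ℝ) * (w k).1 + (e k).2 * (w k).2 = 0 := by exact_mod_cast f.2.2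
      linear_combination 4 * f1 + 4 * f2 - 8 * f3
    have o1 : ((e (k + 1)).1 : ℝ) + (w (k + 1)).1 = (e k).1 - (w k).1 := by exact_mod_cast opp.1
    have o2 : ((e (k + 1)).2 : ℝ) + (w (k + 1)).2 = (e k).2 - (w k).2 := by exact_mod_cast opp.2
    have t1 : ((a k).1 : ℝ) + (e k).1 = (a (k + 1)).1 := by exact_mod_cast s1
    have t2 : ((a k).2 : ℝ) + (e k).2 = (a (k + 1)).2 := by exact_mod_cast s2
    simp only [sqd] at key
    have g1 : ((a k).1 + 0 * (e k).1 + 1 * (w k).1 -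
        ((a (k + 1)).1 + 1 * (e (k + 1)).1 + 1 * (w (k + 1)).1) : ℝ) =
        -(2 * (e k).1 - 2 * (w k).1) := by linarith
    have g2 : ((a k).2 + 0 * (e k).2 + 1 * (w k).2 -
        ((a (k + 1)).2 + 1 * (e (k + 1)).2 + 1 * (w (k + 1)).2) : ℝ) =
        -(2 * (e k).2 - 2 * (w k).2) := by linarith
    rw [g1, g2, neg_sq, neg_sq, sq8] at key
    push_cast at key
    linarith

theorem IsGridCurve.false_of_normal (h : IsGridCurve N p o u w σ) (hlt : RatioLt p)
    (h0 : p 0 = (0, 0)) (h1 : p 1 = (1, 0)) : False := by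
  obtain ⟨d, hF⟩ := exists_isNormal h0 h1 (h.visits 0 (by simp) 1 (by simp))
    (h.visits 1 (by simp) 1 (by simp))
  set e : ℕ → ℤ × ℤ := fun k => bif σ k then u k else -u k with he
  set a : ℕ → ℤ × ℤ := fun k => bif σ k then o k else o k + u k with ha
  have hc : ∀ k < N ^ 2, ∀ t ∈ Icc (0 : ℝ) 1, (N : ℝ) • p ((k + t) / (N ^ 2 : ℕ)) =
      ((a k).1 + (bothWays p (σ k) t).1 * (e k).1 + (bothWays p (σ k) t).2 * (w k).1,
        (a k).2 + (bothWays p (σ k) t).1 * (e k).2 + (bothWays p (σ k) t).2 * (w k).2) := by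
    intro k hk t ht
    have e1 := h.cell_fst k hk t ht
    have e2 := h.cell_snd k hk t ht
    ext
    · simp only [Prod.smul_fst, smul_eq_mul]
      rw [e1]
      simp only [ha, he]
      cases σ k <;> simp [bothWays, _root_.backward]
      ring
    · simp only [Prod.smul_snd, smul_eq_mul]
      rw [e2]
      simp only [ha, he]
      cases σ k <;> simp [bothWays, _root_.backward]
      ring
  have hw := h.frame_symm hlt h0 hF (fun _ => rfl) (fun _ => rfl) hc
  have hch : IsCellChain (bothWays p) (N ^ 2) N p (fun k => ((a k).1, (a k).2))
      (fun k => kleinOf (e k)) σ := by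
    intro k hk t ht
    have hu : (e k).1 ^ 2 + (e k).2 ^ 2 = 1 := by
      have := (h.frame k hk).1
      simp only [he]
      cases σ k <;> simpa using this
    rw [hc k hk t ht, kact_kleinOf hu (hw k hk)]
    ext <;> simp [add_assoc]
  exact hch.false_of_ratioLt hlt (by push_cast; ring) (by exact_mod_cast h.two_le) hF h.mem

theorem IsGridCurve.false_of_lower (h : IsGridCurve N p o u w σ) (hlt : RatioLt p)
    (h0 : (p 0).2 = 0) (h1 : (p 1).2 = 0) : False := by
  rcases h.ends h0 h1 with ⟨e0, e1⟩ | ⟨e0, e1⟩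
  · exact h.false_of_normal hlt e0 e1
  · exact h.flip.false_of_normal hlt.flip (by simp [e0]) (by simp [e1])

/-- A grid curve both ends of which lie on one side of the square has a pair of moments with
square-to-linear ratio at least `5`. -/
theorem IsGridCurve.false_of_side (h : IsGridCurve N p o u w σ) (hlt : RatioLt p)
    (hs : ∃ c : ℝ, (c = 0 ∨ c = 1) ∧ ((p 0).1 = c ∧ (p 1).1 = c ∨ (p 0).2 = c ∧ (p 1).2 = c)) :
    False := by
  obtain ⟨c, rfl | rfl, ⟨e0, e1⟩ | ⟨e0, e1⟩⟩ := hs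
  · exact h.swap.false_of_lower hlt.swap e0 e1
  · exact h.false_of_lower hlt e0 e1
  · exact h.flip.swap.false_of_lower hlt.flip.swap (by simp [e0]) (by simp [e1])
  · exact h.swap.flip.swap.false_of_lower hlt.swap.flip.swap (by simp [e0]) (by simp [e1])

end grid

/-- The coordinate of `q` along the unit vector `u`, with origin `o`. -/
def frameCoord (o u q : ℝ × ℝ) : ℝ := (q.1 - o.1) * u.1 + (q.2 - o.2) * u.2

/-- The points of the closed square of side `s` spanned by the frame `o; u, w`. -/
def InSquare (s : ℝ) (o u w q : ℝ × ℝ) : Prop :=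
  frameCoord o u q ∈ Icc 0 s ∧ frameCoord o w q ∈ Icc 0 s

/-- The points of the open square of side `s` spanned by the frame `o; u, w`. -/
def InOpenSquare (s : ℝ) (o u w q : ℝ × ℝ) : Prop :=
  frameCoord o u q ∈ Ioo 0 s ∧ frameCoord o w q ∈ Ioo 0 s

/-- Two orthonormal vectors of `ℝ × ℝ`. -/
def IsFrame (u w : ℝ × ℝ) : Prop :=
  u.1 ^ 2 + u.2 ^ 2 = 1 ∧ w.1 ^ 2 + w.2 ^ 2 = 1 ∧ u.1 * w.1 + u.2 * w.2 = 0

theorem frameCoord_segment (o u p q : ℝ × ℝ) (r : ℝ) :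
    frameCoord o u (p + r • (q - p)) = (1 - r) * frameCoord o u p + r * frameCoord o u q := by
  simp [frameCoord]
  ring

theorem continuous_frameCoord (o u : ℝ × ℝ) : Continuous (frameCoord o u) := by
  unfold frameCoord
  fun_prop

section square

variable {s : ℝ} {o u w p q : ℝ × ℝ}

theorem InOpenSquare.inSquare (h : InOpenSquare s o u w q) : InSquare s o u w q :=
  ⟨Ioo_subset_Icc_self h.1, Ioo_subset_Icc_self h.2⟩

theorem InSquare.segment (hp : InSquare s o u w p) (hq : InOpenSquare s o u w q) {r : ℝ}
    (h0 : 0 < r) (h1 : r ≤ 1) : InOpenSquare s o u w (p + r • (q - p)) := by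
  obtain ⟨⟨a1, a2⟩, a3, a4⟩ := hp
  obtain ⟨⟨b1, b2⟩, b3, b4⟩ := hq
  unfold InOpenSquare
  rw [frameCoord_segment, frameCoord_segment]
  have h1' : 0 ≤ 1 - r := by linarith
  refine ⟨⟨?_, ?_⟩, ?_, ?_⟩
  · have := mul_pos h0 b1
    have := mul_nonneg h1' a1
    linarith
  · nlinarith [mul_lt_mul_of_pos_left b2 h0, mul_le_mul_of_nonneg_left a2 h1']
  · have := mul_pos h0 b3
    have := mul_nonneg h1' a3
    linarith
  · nlinarith [mul_lt_mul_of_pos_left b4 h0, mul_le_mul_of_nonneg_left a4 h1']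

theorem isOpen_inOpenSquare : IsOpen {q | InOpenSquare s o u w q} :=
  (isOpen_Ioo.preimage (continuous_frameCoord o u)).inter
    (isOpen_Ioo.preimage (continuous_frameCoord o w))

theorem isClosed_inSquare : IsClosed {q | InSquare s o u w q} :=
  (isClosed_Icc.preimage (continuous_frameCoord o u)).inter
    (isClosed_Icc.preimage (continuous_frameCoord o w))

theorem IsOpen.exists_segment {U : Set (ℝ × ℝ)} (hU : IsOpen U) (hp : p ∈ U) (v : ℝ × ℝ) {ε : ℝ}
    (hε : 0 < ε) : ∃ r, 0 < r ∧ r ≤ ε ∧ p + r • v ∈ U := by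
  have hcont : Continuous fun r : ℝ => p + r • v := by fun_prop
  have h1 : ∀ᶠ r : ℝ in nhdsWithin 0 (Ioi 0), p + r • v ∈ U :=
    (hcont.continuousAt.eventually (by simpa using hU.mem_nhds hp)).filter_mono nhdsWithin_le_nhds
  have h2 : ∀ᶠ r : ℝ in nhdsWithin 0 (Ioi 0), r ∈ Ioc 0 ε := Ioc_mem_nhdsGT hε
  obtain ⟨r, hr1, hr2⟩ := (h1.and h2).exists
  exact ⟨r, hr2.1, hr2.2, hr1⟩

theorem IsFrame.frameCoord_left (h : IsFrame u w) (x y : ℝ) :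
    frameCoord o u (o + x • u + y • w) = x := by
  obtain ⟨h1, h2, h3⟩ := h
  simp [frameCoord]
  linear_combination x * h1 + y * h3

theorem IsFrame.frameCoord_right (h : IsFrame u w) (x y : ℝ) :
    frameCoord o w (o + x • u + y • w) = y := by
  obtain ⟨h1, h2, h3⟩ := h
  simp [frameCoord]
  linear_combination y * h2 + x * h3

theorem IsFrame.eq_frame (h : IsFrame u w) (q : ℝ × ℝ) :
    q = o + frameCoord o u q • u + frameCoord o w q • w := by
  obtain ⟨h1, h2, h3⟩ := h
  have k1 : u.1 ^ 2 + w.1 ^ 2 = 1 ∧ u.2 ^ 2 + w.2 ^ 2 = 1 ∧ u.1 * u.2 + w.1 * w.2 = 0 := by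
    have e : (u.1 * w.2 - u.2 * w.1) ^ 2 = 1 := by
      linear_combination (w.1 ^ 2 + w.2 ^ 2) * h1 + h2 - (u.1 * w.1 + u.2 * w.2) * h3
    have e1 : w.1 = -((u.1 * w.2 - u.2 * w.1) * u.2) := by
      linear_combination (-w.1) * h1 + u.1 * h3
    have e2 : w.2 = (u.1 * w.2 - u.2 * w.1) * u.1 := by
      linear_combination (-w.2) * h1 + u.2 * h3
    generalize u.1 * w.2 - u.2 * w.1 = D at *
    rw [e1, e2]
    refine ⟨?_, ?_, ?_⟩
    · linear_combination h1 + u.2 ^ 2 * e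
    · linear_combination h1 + u.1 ^ 2 * e
    · linear_combination (-u.1 * u.2) * e
  obtain ⟨k1, k2, k3⟩ := k1
  ext
  · simp [frameCoord]
    linear_combination (-(q.1 - o.1)) * k1 - (q.2 - o.2) * k3
  · simp [frameCoord]
    linear_combination (-(q.2 - o.2)) * k2 - (q.1 - o.1) * k3

theorem IsFrame.center (h : IsFrame u w) (hs : 0 < s) :
    InOpenSquare s o u w (o + (s / 2) • u + (s / 2) • w) := by
  unfold InOpenSquare
  rw [h.frameCoord_left, h.frameCoord_right]
  exact ⟨⟨by linarith, by linarith⟩, by linarith, by linarith⟩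

/-- A square lying in a quadrant and containing its vertex is parallel to the axes. -/
theorem IsFrame.of_quadrant (h : IsFrame u w) (hs : 0 < s) (hp : InSquare s o u w p)
    (hq : ∀ q, InSquare s o u w q → p.1 ≤ q.1 ∧ p.2 ≤ q.2) :
    (∃ U W : ℤ × ℤ, IsLatticeFrame U W ∧ u = ((U.1 : ℝ), (U.2 : ℝ)) ∧ w = ((W.1 : ℝ), (W.2 : ℝ)) ∧
      ∃ x y : ℤ, p = o + (x * s) • u + (y * s) • w) ∧
    ∀ q, InSquare s o u w q ↔ q.1 ∈ Icc p.1 (p.1 + s) ∧ q.2 ∈ Icc p.2 (p.2 + s) := by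
  have side : ∀ x a b : ℝ, x ∈ Icc 0 s → a ^ 2 + b ^ 2 = 1 →
      (∀ x' ∈ Icc 0 s, 0 ≤ (x' - x) * a ∧ 0 ≤ (x' - x) * b) →
      (x = 0 ∧ 0 ≤ a ∧ 0 ≤ b) ∨ (x = s ∧ a ≤ 0 ∧ b ≤ 0) := by
    intro x a b hx hab hx'
    have c0 := hx' 0 ⟨le_rfl, hs.le⟩
    have c1 := hx' s ⟨hs.le, le_rfl⟩
    rcases hx.1.eq_or_lt with h0 | h0
    · left
      subst h0
      rw [sub_zero] at c1
      exact ⟨rfl, nonneg_of_mul_nonneg_right c1.1 hs, nonneg_of_mul_nonneg_right c1.2 hs⟩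
    · have a0 : a ≤ 0 := by nlinarith [c0.1]
      have b0 : b ≤ 0 := by nlinarith [c0.2]
      rcases hx.2.eq_or_lt with h1 | h1
      · exact Or.inr ⟨h1, a0, b0⟩
      · have a1 : 0 ≤ a := nonneg_of_mul_nonneg_right c1.1 (by linarith)
        have b1 : 0 ≤ b := nonneg_of_mul_nonneg_right c1.2 (by linarith)
        have : a = 0 := le_antisymm a0 a1
        have : b = 0 := le_antisymm b0 b1
        subst a b
        norm_num at hab
  have hpe := h.eq_frame (o := o) p
  obtain ⟨hx, hy⟩ := hp
  generalize frameCoord o u p = x at *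
  generalize frameCoord o w p = y at *
  have sx := side x u.1 u.2 hx h.1 (by
    intro x' hx'
    have := hq (o + x' • u + y • w)
      ⟨by rw [h.frameCoord_left]; exact hx', by rw [h.frameCoord_right]; exact hy⟩
    rw [hpe] at this
    simp at this
    constructor <;> nlinarith [this.1, this.2])
  have sy := side y w.1 w.2 hy h.2.1 (by
    intro y' hy'
    have := hq (o + x • u + y' • w)
      ⟨by rw [h.frameCoord_left]; exact hx, by rw [h.frameCoord_right]; exact hy'⟩
    rw [hpe] at this
    simp at this
    constructor <;> nlinarith [this.1, this.2])
  have hp1 : p.1 = o.1 + x * u.1 + y * w.1 := by rw [hpe]; simp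
  have hp2 : p.2 = o.2 + x * u.2 + y * w.2 := by rw [hpe]; simp
  have hmul : u.1 * w.1 = 0 ∧ u.2 * w.2 = 0 := by
    have h3 := h.2.2
    have key : ∀ a b c d : ℝ, 0 ≤ a → 0 ≤ b → 0 ≤ c → 0 ≤ d → a * c + b * d = 0 →
        a * c = 0 ∧ b * d = 0 := by
      intro a b c d ha hb hc hd habcd
      have := mul_nonneg ha hc
      have := mul_nonneg hb hd
      constructor <;> linarith
    rcases sx with ⟨-, a1, a2⟩ | ⟨-, a1, a2⟩ <;> rcases sy with ⟨-, b1, b2⟩ | ⟨-, b1, b2⟩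
    · exact key _ _ _ _ a1 a2 b1 b2 h3
    · have := key _ _ _ _ a1 a2 (neg_nonneg.2 b1) (neg_nonneg.2 b2) (by linarith)
      constructor <;> linarith
    · have := key _ _ _ _ (neg_nonneg.2 a1) (neg_nonneg.2 a2) b1 b2 (by linarith)
      constructor <;> linarith
    · have := key _ _ _ _ (neg_nonneg.2 a1) (neg_nonneg.2 a2) (neg_nonneg.2 b1)
        (neg_nonneg.2 b2) (by linarith)
      constructor <;> linarith
  obtain ⟨u1, u2⟩ := u
  obtain ⟨w1, w2⟩ := w
  obtain ⟨h1, h2, -⟩ := h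
  simp only at *
  have fin : ∀ (U W : ℤ × ℤ) (m n : ℤ), IsLatticeFrame U W → u1 = U.1 → u2 = U.2 → w1 = W.1 →
      w2 = W.2 → x = m * s → y = n * s →
      ∃ U W : ℤ × ℤ, IsLatticeFrame U W ∧ (u1, u2) = ((U.1 : ℝ), (U.2 : ℝ)) ∧
        (w1, w2) = ((W.1 : ℝ), (W.2 : ℝ)) ∧
        ∃ m n : ℤ, p = o + (m * s) • (u1, u2) + (n * s) • (w1, w2) := by
    rintro U W m n hf rfl rfl rfl rfl rfl rfl
    exact ⟨U, W, hf, rfl, rfl, m, n, hpe⟩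
  have box : ∀ q : ℝ × ℝ, InSquare s o (u1, u2) (w1, w2) q ↔
      (0 ≤ (q.1 - o.1) * u1 + (q.2 - o.2) * u2 ∧ (q.1 - o.1) * u1 + (q.2 - o.2) * u2 ≤ s) ∧
      (0 ≤ (q.1 - o.1) * w1 + (q.2 - o.2) * w2 ∧ (q.1 - o.1) * w1 + (q.2 - o.2) * w2 ≤ s) :=
    fun q => Iff.rfl
  simp only [box, mem_Icc]
  clear box hq hpe side
  have unit : ∀ a b : ℝ, a ^ 2 + b ^ 2 = 1 → b = 0 → a = 1 ∨ a = -1 := by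
    rintro a b hab rfl
    exact mul_self_eq_one_iff.1 (by linarith)
  have unit' : ∀ a b : ℝ, a ^ 2 + b ^ 2 = 1 → a = 0 → b = 1 ∨ b = -1 := by
    rintro a b hab rfl
    exact mul_self_eq_one_iff.1 (by linarith)
  rcases mul_eq_zero.1 hmul.1 with h | h
  · have hu := unit' _ _ h1 h
    have hw : w2 = 0 := by rcases hu with rfl | rfl <;> linarith [hmul.2]
    have hw' := unit _ _ h2 hw
    subst h hw
    rcases hu with rfl | rfl <;> rcases hw' with rfl | rfl <;>
      rcases sx with ⟨rfl, a1, a2⟩ | ⟨rfl, a1, a2⟩ <;> try (exfalso; linarith)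
    all_goals rcases sy with ⟨rfl, b1, b2⟩ | ⟨rfl, b1, b2⟩ <;> try (exfalso; linarith)
    all_goals
      refine ⟨?_, fun q => ⟨fun ⟨⟨c1, c2⟩, c3, c4⟩ => ⟨⟨by linarith, by linarith⟩, by linarith, by linarith⟩,
        fun ⟨⟨c1, c2⟩, c3, c4⟩ => ⟨⟨by linarith, by linarith⟩, by linarith, by linarith⟩⟩⟩
    · exact fin (0, 1) (1, 0) 0 0 (by simp [IsLatticeFrame]) (by simp) (by simp) (by simp) (by simp)
        (by simp) (by simp)
    · exact fin (0, 1) (-1, 0) 0 1 (by simp [IsLatticeFrame]) (by simp) (by simp) (by simp) (by simp)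
        (by simp) (by simp)
    · exact fin (0, -1) (1, 0) 1 0 (by simp [IsLatticeFrame]) (by simp) (by simp) (by simp) (by simp)
        (by simp) (by simp)
    · exact fin (0, -1) (-1, 0) 1 1 (by simp [IsLatticeFrame]) (by simp) (by simp) (by simp) (by simp)
        (by simp) (by simp)
  · have hw' := unit' _ _ h2 h
    have hu : u2 = 0 := by rcases hw' with rfl | rfl <;> linarith [hmul.2]
    have hu' := unit _ _ h1 hu
    subst h hu
    rcases hu' with rfl | rfl <;> rcases hw' with rfl | rfl <;>
      rcases sx with ⟨rfl, a1, a2⟩ | ⟨rfl, a1, a2⟩ <;> try (exfalso; linarith)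
    all_goals rcases sy with ⟨rfl, b1, b2⟩ | ⟨rfl, b1, b2⟩ <;> try (exfalso; linarith)
    all_goals
      refine ⟨?_, fun q => ⟨fun ⟨⟨c1, c2⟩, c3, c4⟩ => ⟨⟨by linarith, by linarith⟩, by linarith, by linarith⟩,
        fun ⟨⟨c1, c2⟩, c3, c4⟩ => ⟨⟨by linarith, by linarith⟩, by linarith, by linarith⟩⟩⟩
    · exact fin (1, 0) (0, 1) 0 0 (by simp [IsLatticeFrame]) (by simp) (by simp) (by simp) (by simp)
        (by simp) (by simp)
    · exact fin (1, 0) (0, -1) 0 1 (by simp [IsLatticeFrame]) (by simp) (by simp) (by simp) (by simp)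
        (by simp) (by simp)
    · exact fin (-1, 0) (0, 1) 1 0 (by simp [IsLatticeFrame]) (by simp) (by simp) (by simp) (by simp)
        (by simp) (by simp)
    · exact fin (-1, 0) (0, -1) 1 1 (by simp [IsLatticeFrame]) (by simp) (by simp) (by simp) (by simp)
        (by simp) (by simp)

end square

/-- An open square and a closed square of a family with disjoint interiors meet only if they belong
to the same member. -/
theorem eq_of_inOpenSquare_of_inSquare {M : ℕ} {s : ℝ} (hs : 0 < s) {o u w : ℕ → ℝ × ℝ}
    (hfr : ∀ k < M, IsFrame (u k) (w k))
    (hdisj : ∀ k < M, ∀ l < M, ∀ q, InOpenSquare s (o k) (u k) (w k) q →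
      InOpenSquare s (o l) (u l) (w l) q → k = l) {k l : ℕ} (hk : k < M) (hl : l < M) {q : ℝ × ℝ}
    (hqk : InOpenSquare s (o k) (u k) (w k) q) (hql : InSquare s (o l) (u l) (w l) q) : k = l := by
  have hc := (hfr l hl).center (o := o l) hs
  obtain ⟨r, hr0, hr1, hr⟩ := isOpen_inOpenSquare.exists_segment hqk
    (o l + (s / 2) • u l + (s / 2) • w l - q) one_pos
  exact hdisj k hk l hl _ hr (hql.segment hc hr0 hr1)

/-- The point belongs to the cell `[i s, (i + 1) s] × [j s, (j + 1) s]`. -/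
def InCell (s : ℝ) (i j : ℕ) (q : ℝ × ℝ) : Prop :=
  q.1 ∈ Icc (i * s) (i * s + s) ∧ q.2 ∈ Icc (j * s) (j * s + s)

/-- The unit square. -/
def InUnit (q : ℝ × ℝ) : Prop := q.1 ∈ Icc (0 : ℝ) 1 ∧ q.2 ∈ Icc (0 : ℝ) 1

/-- A family of equal squares with disjoint interiors tiling the unit square. -/
structure IsTiling (M : ℕ) (s : ℝ) (o u w : ℕ → ℝ × ℝ) : Prop where
  pos : 0 < s
  frame : ∀ k < M, IsFrame (u k) (w k)
  cover : ∀ q, InUnit q → ∃ k < M, InSquare s (o k) (u k) (w k) q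
  sub : ∀ k < M, ∀ q, InSquare s (o k) (u k) (w k) q → InUnit q
  disj : ∀ k < M, ∀ l < M, ∀ q, InOpenSquare s (o k) (u k) (w k) q →
      InOpenSquare s (o l) (u l) (w l) q → k = l

section tiling

variable {M : ℕ} {s : ℝ} {o u w : ℕ → ℝ × ℝ}

theorem IsTiling.step (h : IsTiling M s o u w) {i j : ℕ} (hi : i * s < 1) (hj : j * s < 1)
    (hleft : ∀ i', i' + 1 = i → ∃ k < M, ∀ q, InSquare s (o k) (u k) (w k) q ↔ InCell s i' j q)
    (hbelow : ∀ j', j' + 1 = j → ∀ i' : ℕ, i' * s < 1 →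
      ∃ k < M, ∀ q, InSquare s (o k) (u k) (w k) q ↔ InCell s i' j' q) :
    ∃ k < M, ∀ q, InSquare s (o k) (u k) (w k) q ↔ InCell s i j q := by
  have hs := h.pos
  set P : ℝ × ℝ := (i * s, j * s) with hP
  have hi0 : 0 ≤ i * s := by positivity
  have hj0 : 0 ≤ j * s := by positivity
  -- a square that contains the vertex of the cell and a nearby point of the cell
  obtain ⟨k, hk, hkP, r, hr0, hr⟩ : ∃ k < M, InSquare s (o k) (u k) (w k) P ∧
      ∃ r : ℝ, 0 < r ∧ InSquare s (o k) (u k) (w k) (P + r • (1, 1)) := by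
    set U : Set (ℝ × ℝ) := ⋂ k ∈ {k | k < M ∧ ¬ InSquare s (o k) (u k) (w k) P},
      {q | InSquare s (o k) (u k) (w k) q}ᶜ with hU
    have hUo : IsOpen U :=
      ((Set.finite_lt_nat M).subset fun k hk => hk.1).isOpen_biInter
        fun k _ => isClosed_inSquare.isOpen_compl
    have hPU : P ∈ U := by
      simp only [hU, mem_iInter]
      exact fun k hk => hk.2
    obtain ⟨r, hr0, hr1, hrU⟩ := hUo.exists_segment hPU (1, 1)
      (ε := min (1 - i * s) (1 - j * s)) (lt_min (by linarith) (by linarith))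
    have r1 := hr1.trans (min_le_left _ _)
    have r2 := hr1.trans (min_le_right _ _)
    obtain ⟨k, hk, hkr⟩ := h.cover (P + r • (1, 1)) (by
      simp only [InUnit, hP, Prod.smul_mk, smul_eq_mul, mul_one, Prod.mk_add_mk]
      exact ⟨⟨by linarith, by linarith⟩, by linarith, by linarith⟩)
    refine ⟨k, hk, ?_, r, hr0, hkr⟩
    by_contra hkP
    simp only [hU, mem_iInter] at hrU
    exact hrU k ⟨hk, hkP⟩ hkr
  refine ⟨k, hk, ?_⟩
  -- it does not leave the quadrant
  have bad : ∀ q, InOpenSquare s (o k) (u k) (w k) q → P.1 ≤ q.1 ∧ P.2 ≤ q.2 := by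
    intro q hq
    by_contra hbad
    have hnear : IsOpen {z : ℝ × ℝ | (P.1 - s < z.1 ∧ z.1 < P.1 + s) ∧ P.2 - s < z.2 ∧
        z.2 < P.2 + s} := by
      apply IsOpen.inter
      · exact (isOpen_lt continuous_const continuous_fst).inter
          (isOpen_lt continuous_fst continuous_const)
      · exact (isOpen_lt continuous_const continuous_snd).inter
          (isOpen_lt continuous_snd continuous_const)
    obtain ⟨m, hm0, hm1, ⟨n1, n2⟩, n3, n4⟩ := hnear.exists_segment (p := P)
      ⟨⟨by linarith, by linarith⟩, by linarith, by linarith⟩ (q - P) one_pos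
    have hz := hkP.segment hq hm0 hm1
    have hbad' : ¬ (P.1 ≤ (P + m • (q - P)).1 ∧ P.2 ≤ (P + m • (q - P)).2) := by
      rintro ⟨b1, b2⟩
      simp at b1 b2
      exact hbad ⟨by nlinarith, by nlinarith⟩
    generalize P + m • (q - P) = z at *
    have hzu := h.sub k hk z hz.inSquare
    -- the neighbour containing `z` is the same square, and misses the nearby point
    have contra : ∀ i' j' : ℕ, (i' + 1 = i ∧ j' = j ∨ j' + 1 = j) →
        (∃ l < M, ∀ q, InSquare s (o l) (u l) (w l) q ↔ InCell s i' j' q) →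
        InCell s i' j' z → False := by
      rintro i' j' hij ⟨l, hl, hlc⟩ hzc
      have hkl := eq_of_inOpenSquare_of_inSquare hs h.frame h.disj hk hl hz ((hlc z).2 hzc)
      subst hkl
      have hc := (hlc _).1 hr
      obtain ⟨c1, c2⟩ := hc
      rw [hP] at c1 c2
      simp at c1 c2
      rcases hij with ⟨rfl, rfl⟩ | rfl
      · push_cast at c1
        linarith [c1.2]
      · push_cast at c2
        linarith [c2.2]
    rw [hP] at n1 n2 n3 n4 hbad'
    simp only at n1 n2 n3 n4 hbad'
    by_cases hz2 : z.2 < j * s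
    · rcases Nat.eq_zero_or_pos j with rfl | hjpos
      · simp at hz2
        linarith [hzu.2.1]
      · obtain ⟨j', rfl⟩ : ∃ j', j = j' + 1 := ⟨j - 1, by omega⟩
        push_cast at *
        by_cases hz1 : z.1 < i * s
        · rcases Nat.eq_zero_or_pos i with rfl | hipos
          · simp at hz1
            linarith [hzu.1.1]
          · obtain ⟨i', rfl⟩ : ∃ i', i = i' + 1 := ⟨i - 1, by omega⟩
            push_cast at *
            exact contra i' j' (Or.inr rfl) (hbelow j' rfl i' (by linarith))
              ⟨⟨by linarith, by linarith⟩, by linarith, by linarith⟩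
        · exact contra i j' (Or.inr rfl) (hbelow j' rfl i hi)
              ⟨⟨by linarith, by linarith⟩, by linarith, by linarith⟩
    · have hz1 : z.1 < i * s := by
        by_contra h1
        exact hbad' ⟨by linarith, by linarith⟩
      rcases Nat.eq_zero_or_pos i with rfl | hipos
      · simp at hz1
        linarith [hzu.1.1]
      · obtain ⟨i', rfl⟩ : ∃ i', i = i' + 1 := ⟨i - 1, by omega⟩
        push_cast at *
        exact contra i' j (Or.inl ⟨rfl, rfl⟩) (hleft i' rfl)
          ⟨⟨by linarith, by linarith⟩, by linarith, by linarith⟩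
  have hquad : ∀ q, InSquare s (o k) (u k) (w k) q → P.1 ≤ q.1 ∧ P.2 ≤ q.2 := by
    intro q hq
    by_contra hbad
    have hopen : IsOpen {z : ℝ × ℝ | ¬ (P.1 ≤ z.1 ∧ P.2 ≤ z.2)} := by
      have : IsClosed {z : ℝ × ℝ | P.1 ≤ z.1 ∧ P.2 ≤ z.2} :=
        (isClosed_le continuous_const continuous_fst).inter
          (isClosed_le continuous_const continuous_snd)
      exact this.isOpen_compl
    obtain ⟨m, hm0, hm1, hm⟩ := hopen.exists_segment hbad
      (o k + (s / 2) • u k + (s / 2) • w k - q) one_pos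
    exact hm (bad _ (hq.segment ((h.frame k hk).center hs) hm0 hm1))
  exact ((h.frame k hk).of_quadrant hs hkP hquad).2

theorem IsTiling.exists_cell (h : IsTiling M s o u w) (j : ℕ) :
    ∀ i : ℕ, i * s < 1 → j * s < 1 →
      ∃ k < M, ∀ q, InSquare s (o k) (u k) (w k) q ↔ InCell s i j q := by
  have hs := h.pos
  induction j with
  | zero =>
    intro i
    induction i with
    | zero => exact fun hi hj => h.step hi hj (by omega) (by omega)
    | succ i ih =>
      intro hi hj
      refine h.step hi hj (fun i' hi' => ?_) (by omega)
      obtain rfl : i' = i := by omega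
      exact ih (by push_cast at hi; linarith) hj
  | succ j ihj =>
    intro i
    induction i with
    | zero =>
      intro hi hj
      refine h.step hi hj (by omega) (fun j' hj' i' hi' => ?_)
      obtain rfl : j' = j := by omega
      exact ihj i' hi' (by push_cast at hj; linarith)
    | succ i ih =>
      intro hi hj
      refine h.step hi hj (fun i' hi' => ?_) (fun j' hj' i' hi' => ?_)
      · obtain rfl : i' = i := by omega
        exact ih (by push_cast at hi; linarith) hj
      · obtain rfl : j' = j := by omega
        exact ihj i' hi' (by push_cast at hj; linarith)

/-- A tiling of the unit square by equal squares is a grid. -/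
theorem IsTiling.grid (h : IsTiling M s o u w) :
    ∃ N : ℕ, N * s = 1 ∧ ∀ k < M, ∃ O U W : ℤ × ℤ, IsLatticeFrame U W ∧
      o k = (s * O.1, s * O.2) ∧ u k = ((U.1 : ℝ), (U.2 : ℝ)) ∧ w k = ((W.1 : ℝ), (W.2 : ℝ)) := by
  have hs := h.pos
  have index : ∀ x : ℝ, 0 < x → x < 1 → ∃ i : ℕ, i * s ≤ x ∧ x ≤ i * s + s ∧ (i : ℝ) * s < 1 := by
    intro x hx0 hx1
    have hq : 0 ≤ x / s := by positivity
    have h1 := Nat.floor_le hq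
    have h2 := (Nat.lt_floor_add_one (x / s)).le
    rw [le_div_iff₀ hs] at h1
    rw [div_le_iff₀ hs] at h2
    exact ⟨⌊x / s⌋₊, h1, by linarith, by linarith⟩
  refine ⟨⌈1 / s⌉₊, ?_, fun k hk => ?_⟩
  · have hpos : 0 < ⌈1 / s⌉₊ := Nat.ceil_pos.2 (by positivity)
    obtain ⟨n, hn⟩ : ∃ n, ⌈1 / s⌉₊ = n + 1 := ⟨⌈1 / s⌉₊ - 1, by omega⟩
    have h1 : 1 / s ≤ ⌈1 / s⌉₊ := Nat.le_ceil _
    have h2 : (n : ℝ) < 1 / s := by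
      apply Nat.lt_ceil.1
      omega
    rw [div_le_iff₀ hs] at h1
    rw [lt_div_iff₀ hs] at h2
    obtain ⟨k, hk, hkc⟩ := h.exists_cell 0 n h2 (by simp)
    have := h.sub k hk (n * s + s, 0) ((hkc _).2
      ⟨⟨by simp; linarith, le_rfl⟩, by simp, by simp; linarith⟩)
    have := this.1.2
    rw [hn] at h1 ⊢
    push_cast at *
    linarith
  · have hc := (h.frame k hk).center (o := o k) hs
    set c := o k + (s / 2) • u k + (s / 2) • w k with hcdef
    have hunit : (0 < c.1 ∧ c.1 < 1) ∧ 0 < c.2 ∧ c.2 < 1 := by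
      have key : ∀ v : ℝ × ℝ, ∃ r : ℝ, 0 < r ∧ InUnit (c + r • v) := by
        intro v
        obtain ⟨r, hr, -, hr'⟩ := isOpen_inOpenSquare.exists_segment hc v one_pos
        exact ⟨r, hr, h.sub k hk _ hr'.inSquare⟩
      obtain ⟨r, hr, h1⟩ := key (1, 1)
      obtain ⟨r', hr', h2⟩ := key (-1, -1)
      obtain ⟨⟨a1, a2⟩, a3, a4⟩ := h1
      obtain ⟨⟨b1, b2⟩, b3, b4⟩ := h2
      simp at a1 a2 a3 a4 b1 b2 b3 b4
      exact ⟨⟨by linarith, by linarith⟩, by linarith, by linarith⟩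
    obtain ⟨i, i1, i2, i3⟩ := index c.1 hunit.1.1 hunit.1.2
    obtain ⟨j, j1, j2, j3⟩ := index c.2 hunit.2.1 hunit.2.2
    obtain ⟨l, hl, hlc⟩ := h.exists_cell j i i3 j3
    have hkl := eq_of_inOpenSquare_of_inSquare hs h.frame h.disj hk hl hc
      ((hlc c).2 ⟨⟨i1, i2⟩, j1, j2⟩)
    subst hkl
    obtain ⟨⟨U, W, hf, hu, hw, x, y, hp⟩, -⟩ := (h.frame k hk).of_quadrant hs
      (p := (i * s, j * s)) ((hlc _).2 ⟨⟨le_rfl, by simp; linarith⟩, le_rfl, by simp; linarith⟩)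
      (fun q hq => by
        have := (hlc q).1 hq
        exact ⟨this.1.1, this.2.1⟩)
    refine ⟨(i - x * U.1 - y * W.1, j - x * U.2 - y * W.2), U, W, hf, ?_, hu, hw⟩
    rw [hu, hw] at hp
    have p1 := congrArg Prod.fst hp
    have p2 := congrArg Prod.snd hp
    simp at p1 p2
    ext
    · push_cast
      linarith
    · push_cast
      linarith

end tiling

theorem abs_eq_one_cases {x : ℝ} (h : |x| = 1) : x = 1 ∨ x = -1 := by
  rcases abs_choice x with h' | h' <;> rw [h'] at h
  · exact Or.inl h
  · exact Or.inr (by linarith)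

theorem isometryEquiv_real_cases (h : ℝ ≃ᵢ ℝ) :
    (∀ t, h t = h 0 + t) ∨ ∀ t, h t = h 0 - t := by
  set L := h.toRealAffineIsometryEquiv with hL
  have key : ∀ t, h t = h 0 + t * L.linearIsometryEquiv 1 := by
    intro t
    have := L.map_vadd 0 t
    simp only [vadd_eq_add, add_zero] at this
    rw [← IsometryEquiv.coeFn_toRealAffineIsometryEquiv h, ← hL, this]
    have e : L.linearIsometryEquiv t = t * L.linearIsometryEquiv 1 := by
      have := L.linearIsometryEquiv.map_smul t 1
      simpa using this
    rw [e, add_comm]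
  have hn : |L.linearIsometryEquiv 1| = 1 := by
    have := L.linearIsometryEquiv.norm_map 1
    rwa [Real.norm_eq_abs, norm_one] at this
  rcases abs_eq_one_cases hn with h1 | h1
  · left
    intro t
    rw [key, h1, mul_one]
  · right
    intro t
    rw [key, h1]
    ring

/-- The restriction of the curve to a fractal period is a contracted copy of the curve. -/
theorem IsFractalPeriod.exists_similarity {f : ℝ → Plane} {c d : ℝ}
    (h : IsFractalPeriod f 0 1 c d) : ∃ (σ : Bool) (g : Plane ≃ᵢ Plane), ∀ t ∈ Icc (0 : ℝ) 1,
      f (c + (d - c) * t) = g (√(d - c) • f (bif σ then t else 1 - t)) := by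
  obtain ⟨hcd, -, κ, hκ, φ, g, him, hg⟩ := h
  simp only [mul_zero, mul_one] at him hg
  have hmaps : ∀ t ∈ Icc 0 κ, φ t ∈ Icc c d := fun t ht => him ▸ mem_image_of_mem φ ht
  obtain ⟨t1, ht1, e1⟩ : c ∈ φ '' Icc 0 κ := him ▸ ⟨le_rfl, hcd.le⟩
  obtain ⟨t2, ht2, e2⟩ : d ∈ φ '' Icc 0 κ := him ▸ ⟨hcd.le, le_rfl⟩
  have m0 := hmaps 0 ⟨le_rfl, hκ.le⟩
  have m1 := hmaps κ ⟨hκ.le, le_rfl⟩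
  rcases isometryEquiv_real_cases φ with hφ | hφ <;> rw [hφ] at e1 e2 m1
  · have e0 : φ 0 = c := by linarith [m0.1, ht1.1]
    have eκ : κ = d - c := by linarith [m1.2, ht2.2]
    refine ⟨true, g, fun t ht => ?_⟩
    have := hg (κ * t) ⟨mul_nonneg hκ.le ht.1, mul_le_of_le_one_right hκ.le ht.2⟩
    rw [hφ, e0, mul_div_cancel_left₀ _ hκ.ne', eκ] at this
    exact this.symm
  · have e0 : φ 0 = d := by linarith [m0.2, ht2.1]
    have eκ : κ = d - c := by linarith [m1.1, ht1.2]
    refine ⟨false, g, fun t ht => ?_⟩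
    have := hg (κ * (1 - t)) ⟨mul_nonneg hκ.le (by linarith [ht.2]),
      mul_le_of_le_one_right hκ.le (by linarith [ht.1])⟩
    rw [hφ, e0, mul_div_cancel_left₀ _ hκ.ne', eκ] at this
    rw [cond_false, this]
    congr 1
    ring

/-- An isometry of the plane in coordinates. -/
theorem isometryEquiv_plane_coord (g : Plane ≃ᵢ Plane) : ∃ o u w : ℝ × ℝ, IsFrame u w ∧
    ∀ v : Plane, g v 0 = o.1 + v 0 * u.1 + v 1 * w.1 ∧ g v 1 = o.2 + v 0 * u.2 + v 1 * w.2 := by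
  set A := g.toRealAffineIsometryEquiv with hA
  set L := A.linearIsometryEquiv with hL
  set e0 : Plane := EuclideanSpace.single 0 1
  set e1 : Plane := EuclideanSpace.single 1 1
  have hv : ∀ v : Plane, v = v 0 • e0 + v 1 • e1 := by
    intro v
    ext i
    fin_cases i <;> simp [e0, e1]
  have key : ∀ v : Plane, g v = g 0 + (v 0 • L e0 + v 1 • L e1) := by
    intro v
    have := A.map_vadd 0 v
    simp only [vadd_eq_add, add_zero] at this
    rw [← IsometryEquiv.coeFn_toRealAffineIsometryEquiv g, ← hA, this, add_comm, ← map_smul,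
      ← map_smul, ← map_add, ← hv v]
  have i0 : inner ℝ (L e0) (L e0) = (1 : ℝ) := by
    rw [L.inner_map_map]
    simp [e0]
  have i1 : inner ℝ (L e1) (L e1) = (1 : ℝ) := by
    rw [L.inner_map_map]
    simp [e1]
  have i2 : inner ℝ (L e0) (L e1) = (0 : ℝ) := by
    rw [L.inner_map_map, PiLp.inner_apply, Fin.sum_univ_two]
    simp [e0, e1]
  rw [PiLp.inner_apply, Fin.sum_univ_two] at i0 i1 i2
  simp at i0 i1 i2
  refine ⟨(g 0 0, g 0 1), (L e0 0, L e0 1), (L e1 0, L e1 1), ⟨?_, ?_, ?_⟩, fun v => ?_⟩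
  · simpa using i0
  · simpa using i1
  · simp only
    linarith
  · rw [key v]
    simp [add_assoc]

theorem volume_image_isometryEquiv (g : Plane ≃ᵢ Plane) (S : Set Plane) :
    MeasureTheory.volume (g '' S) = MeasureTheory.volume S := by
  rw [← EuclideanSpace.euclideanHausdorffMeasure_eq_volume 2]
  exact g.isometry.euclideanHausdorffMeasure_image S

/-- Sets covering a set of finite measure and not exceeding it in total measure do not overlap. -/
theorem measure_overlap_eq_zero {α : Type*} [MeasurableSpace α] {μ : MeasureTheory.Measure α}
    {M : ℕ} {Q W : Set α} {S : ℕ → Set α} (hfin : μ Q ≠ ⊤)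
    (hcov : Q ⊆ ⋃ m ∈ Finset.range M, S m) (hsum : ∑ m ∈ Finset.range M, μ (S m) ≤ μ Q) {k l : ℕ}
    (hk : k < M) (hl : l < M) (hkl : k ≠ l) (hW : MeasurableSet W) (hWk : W ⊆ S k) (hWl : W ⊆ S l) :
    μ W = 0 := by
  have hk' : k ∈ Finset.range M := Finset.mem_range.2 hk
  have h1 : Q ⊆ (⋃ m ∈ (Finset.range M).erase k, S m) ∪ (S k \ W) := by
    intro x hx
    obtain ⟨m, hm, hxm⟩ := mem_iUnion₂.1 (hcov hx)
    by_cases hmk : m = k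
    · subst hmk
      by_cases hxW : x ∈ W
      · exact Or.inl (mem_iUnion₂.2 ⟨l, Finset.mem_erase.2 ⟨hkl.symm, Finset.mem_range.2 hl⟩,
          hWl hxW⟩)
      · exact Or.inr ⟨hxm, hxW⟩
    · exact Or.inl (mem_iUnion₂.2 ⟨m, Finset.mem_erase.2 ⟨hmk, hm⟩, hxm⟩)
  have h2 : μ Q ≤ ∑ m ∈ (Finset.range M).erase k, μ (S m) + μ (S k \ W) :=
    (MeasureTheory.measure_mono h1).trans ((MeasureTheory.measure_union_le _ _).trans
      (add_le_add_left (MeasureTheory.measure_biUnion_finset_le _ _) _))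
  have h3 : μ W + μ (S k \ W) = μ (S k) := by
    have := MeasureTheory.measure_inter_add_sdiff (μ := μ) (S k) hW
    rwa [inter_eq_self_of_subset_right hWk] at this
  have h4 : μ Q + μ W ≤ μ Q := calc
    μ Q + μ W ≤ (∑ m ∈ (Finset.range M).erase k, μ (S m) + μ (S k \ W)) + μ W := by gcongr
    _ = ∑ m ∈ (Finset.range M).erase k, μ (S m) + μ (S k) := by
      rw [add_assoc, add_comm (μ (S k \ W)), h3]
    _ = ∑ m ∈ Finset.range M, μ (S m) := Finset.sum_erase_add _ _ hk'
    _ ≤ μ Q := hsum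
  by_contra hne
  exact absurd h4 (not_le.2 (ENNReal.lt_add_right hfin hne))

/-- The members of a regular partition of `[0, 1]` are the segments `[k / M, (k + 1) / M]`. -/
theorem IsRegularPartition.exists_eq {n : ℕ} {l r : Fin n → ℝ} (h : IsRegularPartition l r 0 1) :
    ∃ M : ℕ, 0 < M ∧ ∀ k < M, ∃ i, l i = k / M ∧ r i = (k + 1) / M := by
  obtain ⟨hlt, heq, hU, hdis⟩ := h
  have hmem : ∀ t, t ∈ Icc (0 : ℝ) 1 ↔ ∃ i, t ∈ Icc (l i) (r i) := fun t => by
    rw [← hU, mem_iUnion]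
  obtain ⟨i0, -⟩ := (hmem 0).1 (by simp)
  set L := r i0 - l i0 with hLdef
  have hL : 0 < L := sub_pos.2 (hlt i0)
  have hr : ∀ i, r i = l i + L := fun i => by rw [hLdef, heq i0 i]; ring
  have step : ∀ p, 0 ≤ p → p < 1 → (p = 0 ∨ ∃ i, l i = p - L) → ∃ i, l i = p := by
    intro p hp0 hp1 hprev
    obtain ⟨i, hi1, hi2⟩ : ∃ i, l i ≤ p ∧ p < r i := by
      have hopen : IsOpen (⋂ i ∈ {i | p ∉ Icc (l i) (r i)}, (Icc (l i) (r i))ᶜ) :=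
        (Set.toFinite _).isOpen_biInter fun i _ => isClosed_Icc.isOpen_compl
      have hpU : p ∈ ⋂ i ∈ {i | p ∉ Icc (l i) (r i)}, (Icc (l i) (r i))ᶜ := by
        simp only [mem_iInter]
        exact fun i hi => hi
      have h1 := nhdsWithin_le_nhds (s := Ioi p) (hopen.mem_nhds hpU)
      have h2 : Ioc p 1 ∈ nhdsWithin p (Ioi p) := Ioc_mem_nhdsGT hp1
      obtain ⟨t, ht1, ht2⟩ := Filter.nonempty_of_mem (Filter.inter_mem h1 h2)
      obtain ⟨i, hi⟩ := (hmem t).1 ⟨by linarith [ht2.1], ht2.2⟩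
      simp only [mem_iInter] at ht1
      have hpi : p ∈ Icc (l i) (r i) := by
        by_contra hpi
        exact ht1 i hpi hi
      exact ⟨i, hpi.1, ht2.1.trans_le hi.2⟩
    refine ⟨i, ?_⟩
    by_contra hne
    have hlt' : l i < p := lt_of_le_of_ne hi1 hne
    rcases hprev with rfl | ⟨j, hj⟩
    · have := (hmem (l i)).2 ⟨i, le_rfl, (hlt i).le⟩
      linarith [this.1]
    · by_cases hij : i = j
      · subst hij
        rw [hr] at hi2
        linarith
      · have := hdis i j hij
        rw [interior_Icc, interior_Icc, hr j, hj, Set.disjoint_left] at this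
        have hm : max (l i) (p - L) < p := max_lt hlt' (by linarith)
        obtain ⟨z, hz1, hz2⟩ := exists_between hm
        exact this (a := z) ⟨(le_max_left _ _).trans_lt hz1, hz2.trans hi2⟩
          ⟨(le_max_right _ _).trans_lt hz1, by linarith⟩
  have all : ∀ k : ℕ, k * L < 1 → ∃ i, l i = k * L := by
    intro k
    induction k with
    | zero => exact fun _ => step _ (by simp) (by simp) (Or.inl (by simp))
    | succ k ih =>
      intro hk
      refine step _ (by positivity) hk (Or.inr ?_)
      push_cast at hk ⊢
      obtain ⟨i, hi⟩ := ih (by linarith)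
      exact ⟨i, by rw [hi]; ring⟩
  have hML : (⌈1 / L⌉₊ : ℝ) * L = 1 := by
    have hpos : 0 < ⌈1 / L⌉₊ := Nat.ceil_pos.2 (by positivity)
    obtain ⟨n, hn⟩ : ∃ n, ⌈1 / L⌉₊ = n + 1 := ⟨⌈1 / L⌉₊ - 1, by omega⟩
    have h1 : 1 / L ≤ ⌈1 / L⌉₊ := Nat.le_ceil _
    have h2 : (n : ℝ) < 1 / L := by
      apply Nat.lt_ceil.1
      omega
    rw [div_le_iff₀ hL] at h1
    rw [lt_div_iff₀ hL] at h2
    obtain ⟨i, hi⟩ := all n h2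
    have := ((hmem (r i)).2 ⟨i, (hlt i).le, le_rfl⟩).2
    rw [hr, hi] at this
    rw [hn] at h1 ⊢
    push_cast at *
    linarith
  refine ⟨⌈1 / L⌉₊, Nat.ceil_pos.2 (by positivity), fun k hk => ?_⟩
  generalize ⌈1 / L⌉₊ = M at hML hk
  have hM : (0 : ℝ) < M := by exact_mod_cast (Nat.zero_le k).trans_lt hk
  have hLM : L = 1 / M := by
    field_simp
    linarith
  have hkM : (k : ℝ) < M := by exact_mod_cast hk
  obtain ⟨i, hi⟩ := all k (by rw [← hML]; gcongr)
  refine ⟨i, by rw [hi, hLM]; ring, ?_⟩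
  rw [hr, hi, hLM]
  ring

open scoped Pointwise in
/-- The family of squares into which a regular Peano curve divides the unit square. -/
theorem exists_tiling {f : ℝ → Plane} (hunit : IsUnitPeano f) (hreg : IsRegularPeano f 0 1) :
    ∃ (M : ℕ) (o u w : ℕ → ℝ × ℝ) (σ : ℕ → Bool), 2 ≤ M ∧ IsTiling M √(1 / M) o u w ∧
      ∀ k < M, ∀ t ∈ Icc (0 : ℝ) 1,
        f ((k + t) / M) 0 = (o k).1 + √(1 / M) * (f (bif σ k then t else 1 - t) 0 * (u k).1 +
          f (bif σ k then t else 1 - t) 1 * (w k).1) ∧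
        f ((k + t) / M) 1 = (o k).2 + √(1 / M) * (f (bif σ k then t else 1 - t) 0 * (u k).2 +
          f (bif σ k then t else 1 - t) 1 * (w k).2) := by
  obtain ⟨-, -, -, n, l, r, hpart, hmax⟩ := hreg
  obtain ⟨hcont, himage⟩ := hunit
  obtain ⟨M, hM0, hM⟩ := hpart.exists_eq
  have hMr : (0 : ℝ) < M := by exact_mod_cast hM0
  have hper : ∀ k < M, IsFractalPeriod f 0 1 (k / M) ((k + 1) / M) := by
    intro k hk
    obtain ⟨i, h1, h2⟩ := hM k hk
    exact ((hmax _ _).2 ⟨i, h1, h2⟩).1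
  have hM2 : 2 ≤ M := by
    by_contra hlt
    obtain rfl : M = 1 := by omega
    have := (hper 0 one_pos).2.1
    simp at this
  have hex : ∀ k, ∃ (σ : Bool) (g : Plane ≃ᵢ Plane), k < M → ∀ t ∈ Icc (0 : ℝ) 1,
      f ((k + t) / M) = g (√(1 / M) • f (bif σ then t else 1 - t)) := by
    intro k
    by_cases hk : k < M
    · obtain ⟨σ, g, h⟩ := (hper k hk).exists_similarity
      refine ⟨σ, g, fun _ t ht => ?_⟩
      have e : ((k : ℝ) + 1) / M - k / M = 1 / M := by ring
      have := h t ht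
      rw [e] at this
      rw [← this]
      congr 1
      ring
    · exact ⟨true, IsometryEquiv.refl _, fun h => absurd h hk⟩
  choose σ g hg using hex
  choose o u w hfr hcoord using fun k => isometryEquiv_plane_coord (g k)
  set s := √(1 / (M : ℝ)) with hs
  have hspos : 0 < s := Real.sqrt_pos.2 (by positivity)
  have hs2 : s ^ 2 = 1 / M := Real.sq_sqrt (by positivity)
  have hpiece : ∀ k < M, ∀ t ∈ Icc (0 : ℝ) 1,
        f ((k + t) / M) 0 = (o k).1 + s * (f (bif σ k then t else 1 - t) 0 * (u k).1 +
          f (bif σ k then t else 1 - t) 1 * (w k).1) ∧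
        f ((k + t) / M) 1 = (o k).2 + s * (f (bif σ k then t else 1 - t) 0 * (u k).2 +
          f (bif σ k then t else 1 - t) 1 * (w k).2) := by
    intro k hk t ht
    rw [hg k hk t ht, (hcoord k _).1, (hcoord k _).2]
    simp only [PiLp.smul_apply, smul_eq_mul]
    constructor <;> ring
  have hsq : ∀ v : Plane, v ∈ square 1 ↔ v 0 ∈ Icc (0 : ℝ) 1 ∧ v 1 ∈ Icc (0 : ℝ) 1 := by
    intro v
    simp [square, Fin.forall_fin_two]
  have hcell : ∀ k q, InSquare s (o k) (u k) (w k) q ↔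
      ∃ v ∈ square 1, q = (g k (s • v) 0, g k (s • v) 1) := by
    intro k q
    have hval : ∀ v : Plane, (g k (s • v) 0, g k (s • v) 1) =
        o k + (s * v 0) • u k + (s * v 1) • w k := by
      intro v
      rw [(hcoord k _).1, (hcoord k _).2]
      ext <;> simp
    constructor
    · intro hq
      refine ⟨!₂[frameCoord (o k) (u k) q / s, frameCoord (o k) (w k) q / s], ?_, ?_⟩
      · rw [hsq]
        obtain ⟨⟨a1, a2⟩, a3, a4⟩ := hq
        refine ⟨⟨by simp; positivity, ?_⟩, by simp; positivity, ?_⟩ <;> simp <;>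
          rw [div_le_one hspos] <;> assumption
      · rw [hval]
        simp only [Matrix.cons_val_zero, Matrix.cons_val_one]
        rw [mul_div_cancel₀ _ hspos.ne', mul_div_cancel₀ _ hspos.ne']
        exact (hfr k).eq_frame q
    · rintro ⟨v, hv, rfl⟩
      rw [hsq] at hv
      obtain ⟨⟨a1, a2⟩, a3, a4⟩ := hv
      rw [hval]
      unfold InSquare
      rw [(hfr k).frameCoord_left, (hfr k).frameCoord_right]
      exact ⟨⟨by positivity, by nlinarith⟩, by positivity, by nlinarith⟩
  set S : ℕ → Set Plane := fun k => g k '' (s • square 1) with hS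
  have hmemS : ∀ k (v : Plane), v ∈ S k ↔ InSquare s (o k) (u k) (w k) (v 0, v 1) := by
    intro k v
    rw [hcell]
    simp only [hS, mem_image, Set.mem_smul_set]
    constructor
    · rintro ⟨_, ⟨x, hx, rfl⟩, rfl⟩
      exact ⟨x, hx, rfl⟩
    · rintro ⟨x, hx, h⟩
      refine ⟨_, ⟨x, hx, rfl⟩, ?_⟩
      have h1 := congrArg Prod.fst h
      have h2 := congrArg Prod.snd h
      ext i
      fin_cases i
      · exact h1.symm
      · exact h2.symm
  have hτ : ∀ (b : Bool), ∀ t ∈ Icc (0 : ℝ) 1, (bif b then t else 1 - t) ∈ Icc (0 : ℝ) 1 := by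
    rintro (_ | _) t ht
    · exact ⟨by simpa using ht.2, by simpa using ht.1⟩
    · exact ht
  have hf : ∀ t ∈ Icc (0 : ℝ) 1, f t ∈ square 1 := fun t ht => himage ▸ mem_image_of_mem f ht
  have hcov : square 1 ⊆ ⋃ m ∈ Finset.range M, S m := by
    intro v hv
    rw [← himage] at hv
    obtain ⟨t, ht, rfl⟩ := hv
    obtain ⟨k, hk, x, hx, rfl⟩ : ∃ k < M, ∃ x ∈ Icc (0 : ℝ) 1, t = (k + x) / M := by
      rcases ht.2.eq_or_lt with rfl | hlt
      · refine ⟨M - 1, by omega, 1, by simp, ?_⟩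
        rw [Nat.cast_sub (by omega)]
        field_simp
        push_cast
        ring
      · have hq : 0 ≤ t * M := mul_nonneg ht.1 hMr.le
        have h1 := Nat.floor_le hq
        have h2 := Nat.lt_floor_add_one (t * M)
        refine ⟨⌊t * M⌋₊, ?_, t * M - ⌊t * M⌋₊, ⟨by linarith, by linarith⟩, ?_⟩
        · rw [Nat.floor_lt hq]
          nlinarith
        · field_simp
          ring
    refine mem_iUnion₂.2 ⟨k, Finset.mem_range.2 hk, ?_⟩
    rw [hg k hk x hx]
    exact mem_image_of_mem _ (Set.smul_mem_smul_set (hf _ (hτ _ _ hx)))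
  have hsub : ∀ k < M, S k ⊆ square 1 := by
    rintro k hk _ ⟨_, ⟨v, hv, rfl⟩, rfl⟩
    rw [← himage] at hv
    obtain ⟨t, ht, rfl⟩ := hv
    have := hg k hk _ (hτ (σ k) t ht)
    have e : (bif σ k then (bif σ k then t else 1 - t) else 1 - (bif σ k then t else 1 - t)) = t := by
      cases σ k <;> simp
    rw [e] at this
    change g k (s • f t) ∈ _
    rw [← this]
    apply hf
    have h1 := hτ (σ k) t ht
    have hk' : (k : ℝ) + 1 ≤ M := by exact_mod_cast hk
    exact ⟨by have := h1.1; positivity, by rw [div_le_one hMr]; linarith [h1.2]⟩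
  have hcompact : IsCompact (square 1) := by
    rw [← himage]
    exact isCompact_Icc.image_of_continuousOn hcont
  have hvol : ∀ k, MeasureTheory.volume (S k) =
      ENNReal.ofReal (1 / M) * MeasureTheory.volume (square 1) := by
    intro k
    rw [hS, volume_image_isometryEquiv, MeasureTheory.Measure.addHaar_smul_of_nonneg _ hspos.le]
    simp [hs2]
  have hsum : ∑ m ∈ Finset.range M, MeasureTheory.volume (S m) ≤
      MeasureTheory.volume (square 1) := by
    rw [Finset.sum_congr rfl fun k _ => hvol k, Finset.sum_const, Finset.card_range, nsmul_eq_mul,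
      ← mul_assoc]
    have : (M : ENNReal) * ENNReal.ofReal (1 / M) = 1 := by
      rw [← ENNReal.ofReal_natCast, ← ENNReal.ofReal_mul hMr.le, mul_one_div_cancel hMr.ne',
        ENNReal.ofReal_one]
    rw [this, one_mul]
  refine ⟨M, o, u, w, σ, hM2, ?_⟩
  rw [← hs]
  clear_value s
  refine ⟨⟨hspos, fun k _ => hfr k, ?_, ?_, ?_⟩, hpiece⟩
  · rintro q ⟨h1, h2⟩
    have : (!₂[q.1, q.2] : Plane) ∈ square 1 := by
      rw [hsq]
      exact ⟨by simpa using h1, by simpa using h2⟩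
    obtain ⟨k, hk, hmem⟩ := mem_iUnion₂.1 (hcov this)
    rw [hmemS] at hmem
    exact ⟨k, Finset.mem_range.1 hk, by simpa using hmem⟩
  · intro k hk q hq
    have : (!₂[q.1, q.2] : Plane) ∈ S k := by
      rw [hmemS]
      simpa using hq
    have := (hsq _).1 (hsub k hk this)
    simpa [InUnit] using this
  · intro k hk l hl q hqk hql
    by_contra hkl
    set W : Set Plane := {v | InOpenSquare s (o k) (u k) (w k) (v 0, v 1)} ∩
      {v | InOpenSquare s (o l) (u l) (w l) (v 0, v 1)} with hW
    have hcontin : Continuous fun v : Plane => ((v 0, v 1) : ℝ × ℝ) := by fun_prop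
    have hWo : IsOpen W := (isOpen_inOpenSquare.preimage hcontin).inter
      (isOpen_inOpenSquare.preimage hcontin)
    have hWne : W.Nonempty := ⟨!₂[q.1, q.2], by simpa using hqk, by simpa using hql⟩
    have h0 := measure_overlap_eq_zero (μ := MeasureTheory.volume) hcompact.measure_lt_top.ne hcov
      hsum hk hl hkl hWo.measurableSet (fun v hv => (hmemS k v).2 hv.1.inSquare)
      (fun v hv => (hmemS l v).2 hv.2.inSquare)
    exact (hWo.measure_pos MeasureTheory.volume hWne).ne' h0

/-- A unit regular Peano curve is a grid curve. -/
theorem exists_isGridCurve {f : ℝ → Plane} (hunit : IsUnitPeano f) (hreg : IsRegularPeano f 0 1) :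
    ∃ (N : ℕ) (o u w : ℕ → ℤ × ℤ) (σ : ℕ → Bool),
      IsGridCurve N (fun t => (f t 0, f t 1)) o u w σ := by
  obtain ⟨M, o, u, w, σ, hM2, htil, hpiece⟩ := exists_tiling hunit hreg
  obtain ⟨N, hN, hgrid⟩ := htil.grid
  have hMr : (0 : ℝ) < M := by exact_mod_cast (by omega : 0 < M)
  have hs := htil.pos
  have hs2 : √(1 / (M : ℝ)) ^ 2 = 1 / M := Real.sq_sqrt (by positivity)
  generalize √(1 / (M : ℝ)) = s at *
  have hNM : N ^ 2 = M := by
    have h1 : (N : ℝ) ^ 2 * (1 / M) = 1 := by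
      rw [← hs2, ← mul_pow, hN, one_pow]
    have : (N : ℝ) ^ 2 = M := by
      field_simp at h1
      exact h1
    exact_mod_cast this
  have hN2 : 2 ≤ N := by
    by_contra hlt
    have : N ≤ 1 := by omega
    have : N ^ 2 ≤ 1 := pow_le_one₀ (Nat.zero_le _) this
    omega
  have hgrid' : ∀ k, ∃ O U W : ℤ × ℤ, k < M → IsLatticeFrame U W ∧
      o k = (s * O.1, s * O.2) ∧ u k = ((U.1 : ℝ), (U.2 : ℝ)) ∧ w k = ((W.1 : ℝ), (W.2 : ℝ)) := by
    intro k
    by_cases hk : k < M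
    · obtain ⟨O, U, W, h⟩ := hgrid k hk
      exact ⟨O, U, W, fun _ => h⟩
    · exact ⟨0, 0, 0, fun h => absurd h hk⟩
  choose O U W hOUW using hgrid'
  have hsq : ∀ v : Plane, v ∈ square 1 ↔ v 0 ∈ Icc (0 : ℝ) 1 ∧ v 1 ∈ Icc (0 : ℝ) 1 := by
    intro v
    simp [square, Fin.forall_fin_two]
  refine ⟨N, O, U, W, σ, hN2, ?_, ?_, ?_, ?_, ?_, ?_⟩
  · intro t ht
    exact (hsq _).1 (hunit.2 ▸ mem_image_of_mem f ht)
  · intro x hx y hy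
    have : (!₂[x, y] : Plane) ∈ f '' Icc 0 1 := by
      rw [hunit.2, hsq]
      exact ⟨by simpa using hx, by simpa using hy⟩
    obtain ⟨t, ht, e⟩ := this
    exact ⟨t, ht, by simp [e]⟩
  · intro k hk
    rw [hNM] at hk
    exact (hOUW k hk).1
  · intro k hk t ht
    rw [hNM] at hk ⊢
    obtain ⟨-, h1, h2, h3⟩ := hOUW k hk
    have := (hpiece k hk t ht).1
    rw [h1, h2, h3] at this
    simp only at this ⊢
    rw [this]
    linear_combination ((O k).1 + f (bif σ k then t else 1 - t) 0 * (U k).1 +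
          f (bif σ k then t else 1 - t) 1 * (W k).1) * hN
  · intro k hk t ht
    rw [hNM] at hk ⊢
    obtain ⟨-, h1, h2, h3⟩ := hOUW k hk
    have := (hpiece k hk t ht).2
    rw [h1, h2, h3] at this
    simp only at this ⊢
    rw [this]
    linear_combination ((O k).2 + f (bif σ k then t else 1 - t) 0 * (U k).2 +
          f (bif σ k then t else 1 - t) 1 * (W k).2) * hN
  · intro k hk l hl e1 e2
    rw [hNM] at hk hl
    have hck := (htil.frame k hk).center (o := o k) hs
    have hcl := (htil.frame l hl).center (o := o l) hs
    refine htil.disj k hk l hl _ hck ?_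
    have e : o k + (s / 2) • u k + (s / 2) • w k = o l + (s / 2) • u l + (s / 2) • w l := by
      obtain ⟨-, h1, h2, h3⟩ := hOUW k hk
      obtain ⟨-, h1', h2', h3'⟩ := hOUW l hl
      rw [h1, h2, h3, h1', h2', h3']
      have r1 : 2 * ((O k).1 : ℝ) + (U k).1 + (W k).1 = 2 * (O l).1 + (U l).1 + (W l).1 := by
        exact_mod_cast e1
      have r2 : 2 * ((O k).2 : ℝ) + (U k).2 + (W k).2 = 2 * (O l).2 + (U l).2 + (W l).2 := by
        exact_mod_cast e2
      ext
      · simp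
        linear_combination (s / 2) * r1
      · simp
        linear_combination (s / 2) * r2
    rw [e]
    exact hcl

theorem mainTheorem1 (f : ℝ → Plane) (hunit : IsUnitPeano f) (hreg : IsRegularPeano f 0 1)
    (hside : IsOneSided f) :
    ∃ t ∈ Set.Icc (0 : ℝ) 1, ∃ t' ∈ Set.Icc (0 : ℝ) 1, t ≠ t' ∧ 5 ≤ squareLinearRatio f t t' := by
  by_contra! hcon
  obtain ⟨N, o, u, w, σ, hgrid⟩ := exists_isGridCurve hunit hreg
  refine hgrid.false_of_side ?_ ?_
  · intro t ht t' ht' htt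
    have h := hcon t ht t' ht' htt.ne
    have hpos : 0 < |t - t'| := abs_pos.2 (sub_ne_zero.2 htt.ne)
    unfold squareLinearRatio at h
    rw [div_lt_iff₀ hpos, EuclideanSpace.dist_sq_eq, Fin.sum_univ_two, abs_sub_comm,
      abs_of_pos (sub_pos.2 htt), Real.dist_eq, Real.dist_eq, sq_abs, sq_abs] at h
    exact h
  · obtain ⟨S, ⟨i, e, he, rfl⟩, h0, h1⟩ := hside
    refine ⟨e, he, ?_⟩
    fin_cases i
    · exact Or.inl ⟨h0.2, h1.2⟩
    · exact Or.inr ⟨h0.2, h1.2⟩
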